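/- Let $A$ be a finite alphabet. An atomic operation is a letter of $A$, the backspace $\leftarrow$, or one of the arrows $\blacktriangleleft,\blacktriangleright$. It acts on configurations $\langle u|v\rangle\in A^*\times A^*$ by $\langle u|v\rangle\cdot a=\langle ua|v\rangle$ for $a\in A$, $\langle ua|v\rangle\cdot{\leftarrow}=\langle u|v\rangle$, $\langle ua|v\rangle\cdot{\blacktriangleleft}=\langle u|av\rangle$, $\langle u|av\rangle\cdot{\blacktriangleright}=\langle ua|v\rangle$, and $\leftarrow,\blacktriangleleft$ (resp. $\blacktriangleright$) leave $\langle\epsilon|v\rangle$ (resp. $\langle u|\epsilon\rangle$) unchanged. A key is a finite sequence of atomic operations, applied one after the other. A keyboard is a pair $K=(T,F)$ of finite sets of keys; its size is $|K|=\sum_{t\in T\cup F}(|t|+1)$, and its language $L(K)\subseteq A^*$ is the set of all words $uv$ such that $\langle\epsilon|\epsilon\rangle\cdot t_1\cdots t_n\cdot f=\langle u|v\rangle$ for some $n\ge 0$, $t_1,\dots,t_n\in T$ and $f\in F$. The class $\mathsf{BEK}$ consists of the keyboards whose keys contain no arrow. Theorem. For every keyboard $K$ in $\mathsf{BEK}$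 the language $L(K)$ is regular. Moreover, an NFA recognising $L(K)$ can be built in polynomial time: there are a deterministic multi-stack Turing machine $M$ and a polynomial $p$, depending only on $A$, such that for every $K=(T,F)$ in $\mathsf{BEK}$, when $M$ is given the keys of $T$ and the keys of $F$ as input (in any order, without repetition), it halts after at most $p(|K|)$ steps and outputs an explicit description (number of states in unary, initial states, accepting states, transitions) of an NFA without $\epsilon$-transitions that recognises $L(K)$. -/

import Mathlib

namespace KeyboardLang

/-- The atomic operations over the alphabet `A`: the letters and the three special symbols. -/
inductive Op (A : Type) : Type
  | letter (a : A) : Op A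
  | backspace : Op A
  | leftArrow : Op A
  | rightArrow : Op A

/-- A configuration `⟨u | v⟩`: the word `left` before the cursor and the word `right` after it,
both read from left to right. -/
@[ext]
structure Config (A : Type) : Type where
  left : List A
  right : List A

/-- The empty configuration. -/
def Config.empty (A : Type) : Config A := ⟨[], []⟩

/-- The action of an atomic operation on a configuration. Backspace and left arrow have no effect
when the left word is empty, right arrow has none when the right word is empty. -/
def Config.act {A : Type} (c : Config A) : Op A → Config A
  | .letter a => ⟨c.left ++ [a], c.right⟩
  | .backspace => ⟨c.left.dropLast, c.right⟩
  | .leftArrow => ⟨c.left.dropLast, c.left.getLast?.toList ++ c.right⟩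
  | .rightArrow => ⟨c.left ++ c.right.head?.toList, c.right.tail⟩

/-- A key is a finite sequence of atomic operations. -/
abbrev Key (A : Type) : Type := List (Op A)

/-- The action of a key: its operations are applied one after the other. -/
def Config.actKey {A : Type} (c : Config A) (t : Key A) : Config A := t.foldl Config.act c

/-- The action of a sequence of keys. -/
def Config.actKeys {A : Type} (c : Config A) (τ : List (Key A)) : Config A :=
  τ.foldl Config.actKey c

/-- A keyboard (with entry): a finite set of transient keys and a finite set of final keys. -/
structure Keyboard (A : Type) : Type where
  transientKeys : Finset (Key A)
  finalKeys : Finset (Key A)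

namespace Keyboard

/-- The language of a keyboard `(T, F)`: the contents `u v` of the configurations `⟨u | v⟩` that
are reached from the empty configuration by applying finitely many (possibly no) keys of `T`, and
then one key of `F`. -/
def language {A : Type} (K : Keyboard A) : Language A :=
  {w | ∃ (τ : List (Key A)) (f : Key A) (u v : List A),
    (∀ t ∈ τ, t ∈ K.transientKeys) ∧ f ∈ K.finalKeys ∧
      (Config.empty A).actKeys (τ ++ [f]) = ⟨u, v⟩ ∧ w = u ++ v}

/-- The class `BEK`: the only special symbol that occurs in the keys is the backspace. -/
def IsBEK {A : Type} (K : Keyboard A) : Prop :=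
  ∀ t, t ∈ K.transientKeys ∨ t ∈ K.finalKeys → Op.leftArrow ∉ t ∧ Op.rightArrow ∉ t

open Classical in
/-- The size `|K| = ∑ (|t| + 1)`, where the sum runs over the keys `t ∈ T ∪ F`. -/
noncomputable def size {A : Type} (K : Keyboard A) : ℕ :=
  ∑ t ∈ K.transientKeys ∪ K.finalKeys, (t.length + 1)

/-- `(T, F)` lists the transient keys and the final keys of `K`, in some order and without
repetition. -/
def IsListing {A : Type} (K : Keyboard A) (T F : List (Key A)) : Prop :=
  (T : Multiset (Key A)) = K.transientKeys.val ∧ (F : Multiset (Key A)) = K.finalKeys.val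

end Keyboard

/-- The symbols used to write down a keyboard on the input stack of a machine. -/
inductive InSymbol (A : Type) : Type
  | op (σ : Op A) : InSymbol A
  | endKey : InSymbol A
  | endTransient : InSymbol A

/-- Each key is written out and followed by an end marker. -/
def encodeKeys {A : Type} (l : List (Key A)) : List (InSymbol A) :=
  l.flatMap fun t => t.map InSymbol.op ++ [InSymbol.endKey]

/-- The encoding of a listed keyboard: the transient keys, a marker, the final keys. -/
def encodeKeyboard {A : Type} (T F : List (Key A)) : List (InSymbol A) :=
  encodeKeys T ++ InSymbol.endTransient :: encodeKeys F

/-- An explicitly listed nondeterministic finite automaton with states `0, …, numStates - 1`,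
without `ε`-transitions. -/
structure ListedNFA (A : Type) : Type where
  numStates : ℕ
  start : List (Fin numStates)
  accept : List (Fin numStates)
  trans : List (Fin numStates × A × Fin numStates)

/-- The automaton described by the lists. -/
def ListedNFA.toNFA {A : Type} (N : ListedNFA A) : NFA A (Fin N.numStates) where
  step p a := {q | (p, a, q) ∈ N.trans}
  start := {q | q ∈ N.start}
  accept := {q | q ∈ N.accept}

/-- The symbols used to write down an automaton on the output stack of a machine. -/
inductive OutSymbol (A : Type) : Type
  | tick : OutSymbol A
  | letter (a : A) : OutSymbol A
  | endItem : OutSymbol A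
  | endBlock : OutSymbol A

/-- Natural numbers are written in unary. -/
def encodeUnary (A : Type) (n : ℕ) : List (OutSymbol A) := List.replicate n OutSymbol.tick

/-- The encoding of an automaton: the number of states, the initial states, the accepting states
and the transitions, in four blocks. -/
def ListedNFA.encode {A : Type} (N : ListedNFA A) : List (OutSymbol A) :=
  encodeUnary A N.numStates ++ OutSymbol.endBlock ::
  ((N.start.flatMap fun q => encodeUnary A q ++ [OutSymbol.endItem]) ++ OutSymbol.endBlock ::
  ((N.accept.flatMap fun q => encodeUnary A q ++ [OutSymbol.endItem]) ++ OutSymbol.endBlock ::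
  (N.trans.flatMap fun e =>
    encodeUnary A e.1 ++ OutSymbol.letter e.2.1 :: (encodeUnary A e.2.2 ++ [OutSymbol.endItem]))))

/-- Started with the word `x` on its input stack and all other stacks empty, the multi-stack
Turing machine `M` halts after at most `n` steps, with the word `y` on its output stack and all
other stacks empty. -/
def OutputsWithin {Γ₀ Γ₁ : Type} (M : Turing.TM2ComputableAux Γ₀ Γ₁) (x : List Γ₀) (y : List Γ₁)
    (n : ℕ) : Prop :=
  Nonempty (Turing.TM2OutputsInTime M.tm (x.map M.inputAlphabet.symm)
    (some (y.map M.outputAlphabet.symm)) n)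

end KeyboardLang

/-! A keyboard without arrows acts on the word before the cursor as on a stack: a letter is a push,
a backspace is a pop that has no effect on the empty stack. Reading the written keyboard position by
position thus gives a pushdown system whose states are the positions in the input, where all keys
begin in the state `0`, and the words of the language are the stack contents with which the end of a
final key is reached (`automaton_accepts_eq_language`).

The reachable stack contents are described, from the bottom to the top, by the positions of the
letters that were pushed and never popped. What happens between two such pushes takes place above
the lower one, and is summarised by the relation `Rel` on positions: which states can be reached
after the push with the same stack, without going below it. This relation is the least one that is
closed under five rules with at most two premises. The automaton has the positions as states; it
moves from the position `p` of a letter to the position `q` of the next one if `Rel` leads from `p`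
to the state in which the cell at `q` is executed (`reachable_iff`). The bottom of the stack, where
a pop has no effect, is represented by the position of the separator between the transient and the
final keys.

For inputs of length `n`, `Rel` is a table with `n²` entries, and it is computed by applying all
rules to all positions in `n²` rounds, since every round adds an entry or shows that the table is
closed (`Cmd.saturate_spec`). To carry this out on a multi-stack Turing machine, two languages are
put in between. Programs of type `Prog` are structured programs on stacks; they are translated to
machines whose labels are the finitely many lists of programs that may remain to be executed
(`Prog.Runs.outputs`). Programs of type `Cmd` consist of loops over the positions, accesses to the
array of cells and to the table, and output instructions. As all their loops are bounded, their
translation to `Prog` always runs in polynomial time (`Cmd.compile_runs`), so that only the effect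
of the algorithm has to be verified. -/

namespace KeyboardLang

open Turing Function

/-! ### Structured programs on stacks -/

/-- Structured programs acting on a family of stacks. The only data are the contents of the stacks:
a popped symbol is passed on through the control flow. -/
inductive Prog {K : Type} (Γ : K → Type) : Type
  /-- Do nothing. -/
  | skip : Prog Γ
  /-- Push a symbol on the stack `k`. -/
  | push (k : K) (a : Γ k) : Prog Γ
  /-- Pop the stack `k` and continue with the program that belongs to the result. -/
  | pop (k : K) (f : Option (Γ k) → Prog Γ) : Prog Γ
  /-- Run two programs one after the other. -/
  | seq (P Q : Prog Γ) : Prog Γ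
  /-- While the stack `k` is nonempty, pop it and run the program that belongs to the symbol. -/
  | drain (k : K) (f : Γ k → Prog Γ) : Prog Γ

namespace Prog

variable {K : Type} [DecidableEq K] {Γ : K → Type}

/-- `Runs P s t s'`: started on the stacks `s`, the program `P` terminates with the stacks `s'`,
and its translation to a Turing machine makes at most `t` steps. -/
inductive Runs : Prog Γ → (∀ k, List (Γ k)) → ℕ → (∀ k, List (Γ k)) → Prop
  | skip {s t} : 1 ≤ t → Runs skip s t s
  | push {k a s t} : 1 ≤ t → Runs (push k a) s t (update s k (a :: s k))
  | popNil {k f s s' n t} : s k = [] → Runs (f none) s n s' → n + 1 ≤ t → Runs (pop k f) s t s'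
  | popCons {k f s s' a l n t} : s k = a :: l → Runs (f (some a)) (update s k l) n s' →
      n + 1 ≤ t → Runs (pop k f) s t s'
  | seq {P Q s s' s'' n m t} : Runs P s n s' → Runs Q s' m s'' → n + m + 1 ≤ t →
      Runs (seq P Q) s t s''
  | drainNil {k f s t} : s k = [] → 1 ≤ t → Runs (drain k f) s t s
  | drainCons {k f s s' s'' a l n m t} : s k = a :: l → Runs (f a) (update s k l) n s' →
      Runs (drain k f) s' m s'' → n + m + 1 ≤ t → Runs (drain k f) s t s''

theorem Runs.mono {P : Prog Γ} {s s' : ∀ k, List (Γ k)} {t t' : ℕ} (h : Runs P s t s')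
    (ht : t ≤ t') : Runs P s t' s' := by
  cases h with
  | skip h => exact .skip (h.trans ht)
  | push h => exact .push (h.trans ht)
  | popNil h1 h2 h => exact .popNil h1 h2 (h.trans ht)
  | popCons h1 h2 h => exact .popCons h1 h2 (h.trans ht)
  | seq h1 h2 h => exact .seq h1 h2 (h.trans ht)
  | drainNil h1 h => exact .drainNil h1 (h.trans ht)
  | drainCons h1 h2 h3 h => exact .drainCons h1 h2 h3 (h.trans ht)

/-- The control points that are visited while `P` runs and `c` remains to be executed after it. A
control point is the list of the programs that remain to be executed. -/
def points : Prog Γ → List (Prog Γ) → Set (List (Prog Γ))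
  | skip, c => {skip :: c}
  | push k a, c => {push k a :: c}
  | pop k f, c => {pop k f :: c} ∪ ⋃ o, points (f o) c
  | seq P Q, c => {seq P Q :: c} ∪ (points P (Q :: c) ∪ points Q c)
  | drain k f, c => {drain k f :: c} ∪ ⋃ a, points (f a) (drain k f :: c)

omit [DecidableEq K] in
theorem points_finite [∀ k, Finite (Γ k)] (P : Prog Γ) (c : List (Prog Γ)) :
    (points P c).Finite := by
  induction P generalizing c with
  | skip => exact Set.finite_singleton _
  | push k a => exact Set.finite_singleton _
  | pop k f ih => exact (Set.finite_singleton _).union (Set.finite_iUnion fun o => ih o c)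
  | seq P Q ihP ihQ => exact (Set.finite_singleton _).union ((ihP _).union (ihQ _))
  | drain k f ih => exact (Set.finite_singleton _).union (Set.finite_iUnion fun o => ih o _)

omit [DecidableEq K] in
theorem self_mem_points (P : Prog Γ) (c : List (Prog Γ)) : P :: c ∈ points P c := by
  cases P <;> simp [points]

/-- The translation of a control point to a statement of a stack machine whose labels are of
type `Λ`; `r` finds the label of a control point. The internal state remembers for each stack
the result of the last `pop`. -/
def toStmt {Λ : Type} (r : List (Prog Γ) → Λ) :
    List (Prog Γ) → TM2.Stmt Γ Λ (∀ k, Option (Γ k))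
  | [] => .load (fun _ _ => none) .halt
  | skip :: c => .goto fun _ => r c
  | push k a :: c => .push k (fun _ => a) (.goto fun _ => r c)
  | pop k f :: c => .pop k (fun v o => update v k o) (.goto fun v => r (f (v k) :: c))
  | seq P Q :: c => .goto fun _ => r (P :: Q :: c)
  | drain k f :: c => .pop k (fun v o => update v k o)
      (.goto fun v => match v k with
        | none => r c
        | some a => r (f a :: drain k f :: c))

/-- The steps of the machine simulate the runs of the program. -/
theorem Runs.reaches {Λ : Type} {L : Set (List (Prog Γ))} (r : List (Prog Γ) → Λ)
    (m : Λ → TM2.Stmt Γ Λ (∀ k, Option (Γ k))) (hm : ∀ c ∈ L, m (r c) = toStmt r c)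
    {P : Prog Γ} {s s' : ∀ k, List (Γ k)} {t : ℕ} (h : Runs P s t s')
    (c : List (Prog Γ)) (hc : points P c ⊆ L) (v : ∀ k, Option (Γ k)) :
    ∃ v' n, n ≤ t ∧ (flip bind (TM2.step m))^[n] (some ⟨some (r (P :: c)), v, s⟩) =
      some ⟨some (r c), v', s'⟩ := by
  -- one step at the control point, followed by `n` further steps
  have key : ∀ {P c v s x n y}, points P c ⊆ L → TM2.stepAux (toStmt r (P :: c)) v s = x →
      (flip bind (TM2.step m))^[n] (some x) = y →
      (flip bind (TM2.step m))^[n + 1] (some ⟨some (r (P :: c)), v, s⟩) = y := by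
    intro P c v s x n y hc hx hy
    rw [Function.iterate_succ_apply]
    have : flip bind (TM2.step m) (some ⟨some (r (P :: c)), v, s⟩) = some x := by
      simp only [flip, Option.bind_eq_bind, Option.bind_some, TM2.step]
      rw [hm _ (hc (self_mem_points P c)), hx]
    rw [this, hy]
  induction h generalizing c v with
  | skip h => exact ⟨v, 1, h, key (n := 0) hc rfl rfl⟩
  | push h => exact ⟨v, 1, h, key (n := 0) hc rfl rfl⟩
  | @popNil k f s s' n t h1 h2 h ih =>
    obtain ⟨v', n, hn, h'⟩ := ih c (fun x hx => hc (Or.inr (Set.mem_iUnion.2 ⟨_, hx⟩)))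
      (update v k none)
    refine ⟨v', n + 1, by omega, key hc ?_ h'⟩
    simp [toStmt, h1]
  | @popCons k f s s' a l n t h1 h2 h ih =>
    obtain ⟨v', n, hn, h'⟩ := ih c (fun x hx => hc (Or.inr (Set.mem_iUnion.2 ⟨_, hx⟩)))
      (update v k (some a))
    exact ⟨v', n + 1, by omega, key hc (by simp [toStmt, h1]) h'⟩
  | seq g1 g2 h ih1 ih2 =>
    obtain ⟨v1, n1, hn1, h1⟩ := ih1 _ (fun x hx => hc (Or.inr (Or.inl hx))) v
    obtain ⟨v2, n2, hn2, h2⟩ := ih2 c (fun x hx => hc (Or.inr (Or.inr hx))) v1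
    refine ⟨v2, n2 + n1 + 1, by omega, key (n := n2 + n1) hc rfl ?_⟩
    rw [Function.iterate_add_apply]
    exact (congrArg _ h1).trans h2
  | @drainNil k f s t h1 h =>
    refine ⟨update v k none, 1, h, key (n := 0) hc ?_ rfl⟩
    simp [toStmt, h1]
  | @drainCons k f s s' s'' a l n m t h1 h2 h3 h ih1 ih2 =>
    obtain ⟨v1, n1, hn1, h1'⟩ := ih1 _
      (fun x hx => hc (Or.inr (Set.mem_iUnion.2 ⟨_, hx⟩))) (update v k (some a))
    obtain ⟨v2, n2, hn2, h2'⟩ := ih2 c hc v1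
    refine ⟨v2, n2 + n1 + 1, by omega, key hc (x := _) (by simp [toStmt, h1]; rfl) ?_⟩
    rw [Function.iterate_add_apply, h1', h2']

/-- The labels of the machine that executes `P`: the control points, and the end of the program. -/
def labels (P : Prog Γ) : Set (List (Prog Γ)) := insert [] (points P [])

open Classical in
/-- The label of a control point (by convention the end of the program, for control points that
do not occur). -/
noncomputable def label (P : Prog Γ) (c : List (Prog Γ)) : labels P :=
  if h : c ∈ labels P then ⟨c, h⟩ else ⟨[], Set.mem_insert _ _⟩

/-- The stack machine that executes `P`, with input stack `k₀` and output stack `k₁`. -/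
noncomputable def machine [Fintype K] [∀ k, Finite (Γ k)] (P : Prog Γ) (k₀ k₁ : K) : FinTM2 where
  K := K
  k₀ := k₀
  k₁ := k₁
  Γ := Γ
  Λ := labels P
  main := label P [P]
  ΛFin := ((points_finite P []).insert []).fintype
  σ := ∀ k, Option (Γ k)
  initialState := fun _ => none
  σFin := Fintype.ofFinite _
  Γk₀Fin := Fintype.ofFinite _
  m := fun l => toStmt (label P) l.1

theorem dite_eq_update (k₀ : K) (x : List (Γ k₀)) (k : K) :
    (@dite (List (Γ k)) (k = k₀) _ (fun h => by rw [h]; exact x) fun _ => []) =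
      update (fun _ => []) k₀ x k := by
  by_cases hk : k = k₀
  · subst hk; simp
  · rw [update_of_ne hk, dif_neg hk]

/-- A run of the program from the input stack to the output stack is a computation of its
machine. -/
theorem Runs.outputs [Fintype K] [∀ k, Finite (Γ k)] {P : Prog Γ} {k₀ k₁ : K} {x : List (Γ k₀)}
    {y : List (Γ k₁)} {t : ℕ}
    (h : Runs P (update (fun _ => []) k₀ x) t (update (fun _ => []) k₁ y)) :
    Nonempty (TM2OutputsInTime (machine P k₀ k₁) x (some y) (t + 1)) := by
  have hm : ∀ c ∈ labels P, (machine P k₀ k₁).m (label P c) = toStmt (label P) c := by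
    intro c hc
    simp [machine, label, hc]
  obtain ⟨v, n, hn, hv⟩ := h.reaches (label P) (machine P k₀ k₁).m hm []
    (Set.subset_insert _ _) (fun _ => none)
  have hi : initList (machine P k₀ k₁) x =
      ⟨some (label P [P]), fun _ => none, update (fun _ => []) k₀ x⟩ :=
    congrArg (TM2.Cfg.mk _ _) (funext fun k => dite_eq_update k₀ x k)
  have ho : haltList (machine P k₀ k₁) y = ⟨none, fun _ => none, update (fun _ => []) k₁ y⟩ :=
    congrArg (TM2.Cfg.mk _ _) (funext fun k => dite_eq_update k₁ y k)
  refine ⟨⟨⟨n + 1, ?_⟩, Nat.succ_le_succ hn⟩⟩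
  change (flip bind (TM2.step (machine P k₀ k₁).m))^[n + 1]
    (some (initList (machine P k₀ k₁) x)) = some (haltList (machine P k₀ k₁) y)
  rw [hi, ho, Function.iterate_succ_apply']
  refine (congrArg _ hv).trans ?_
  change some (TM2.stepAux ((machine P k₀ k₁).m (label P [])) _ _) = _
  rw [hm [] (Set.mem_insert _ _)]
  rfl

end Prog

namespace Prog

/-! ### Stacks with an auxiliary copy -/

variable {B : Type} [DecidableEq B] {G : B → Type}

/-- Move the auxiliary copy of `k` back. Every stack `k` has two versions `(k, false)` and `(k, true)`;
the second one is empty, except while the first one is being traversed. -/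
def restore (k : B) : Prog fun p : B × Bool => G p.1 :=
  drain (k, true) fun a => push (k, false) a

/-- Run `P` once for each symbol on the stack `v`, which is preserved. -/
def iter (v : B) (P : Prog fun p : B × Bool => G p.1) : Prog fun p : B × Bool => G p.1 :=
  seq (drain (v, false) fun a => seq (push (v, true) a) P) (restore v)

/-- Move the stack `v`, and as many symbols from the top of `k`, to the auxiliary copies. -/
def shift (v k : B) : Prog fun p : B × Bool => G p.1 :=
  drain (v, false) fun a => seq (push (v, true) a)
    (pop (k, false) fun o => o.elim skip fun b => push (k, true) b)

/-- Random access: apply `w` to the entry of the stack `k` whose index is the height of the stack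
`v`, and continue with the program that belongs to its old value. -/
def access (v k : B) (w : G k → G k) (f : Option (G k) → Prog fun p : B × Bool => G p.1) :
    Prog fun p : B × Bool => G p.1 :=
  seq (shift v k) (pop (k, false) fun o =>
    seq (o.elim skip fun b => push (k, false) (w b)) (seq (restore k) (seq (restore v) (f o))))

theorem restore_runs (k : B) (s : ∀ p : B × Bool, List (G p.1)) :
    Runs (restore k) s (2 * (s (k, true)).length + 1)
      (update (update s (k, true) []) (k, false) ((s (k, true)).reverse ++ s (k, false))) := by
  generalize hl : s (k, true) = l
  induction l generalizing s with
  | nil =>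
    have : update (update s (k, true) []) (k, false) (([] : List (G k)).reverse ++ s (k, false)) =
        s := by
      funext p
      by_cases h1 : p = (k, false)
      · subst h1; simp
      · by_cases h2 : p = (k, true)
        · subst h2; simp [hl]
        · simp [h1, h2]
    rw [this]
    exact .drainNil hl (by simp)
  | cons a l ih =>
    refine .drainCons hl (.push le_rfl)
      ((ih (update (update s (k, true) l) (k, false)
        (a :: update s (k, true) l (k, false))) (by simp)).mono le_rfl |> (cast ?_ ·))
      (n := 1) (m := 2 * l.length + 1) (by simp; omega)
    congr 1
    funext p
    by_cases h1 : p = (k, false)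
    · subst h1; simp
    · by_cases h2 : p = (k, true)
      · subst h2; simp
      · simp [h1, h2]

/-- If `P` applies `F` to the stack `a`, then `iter v P` applies the iterate of `F` whose exponent
is the height of `v`. The condition `Ok` is whatever `P` requires of the other stacks; since `v` is
partly moved to its auxiliary copy when `P` runs, it must not depend on `v` or `a`. -/
theorem iter_runs {v : B} {P : Prog fun p : B × Bool => G p.1} {a : B × Bool}
    (ha : a.1 ≠ v) {F : List (G a.1) → List (G a.1)} {c : ℕ}
    {Ok : (∀ p : B × Bool, List (G p.1)) → Prop}
    (hOk : ∀ s b l, Ok s → Ok (update s (v, b) l)) (hOk' : ∀ s l, Ok s → Ok (update s a l))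
    (hP : ∀ s, Ok s → Runs P s c (update s a (F (s a))))
    (s : ∀ p : B × Bool, List (G p.1)) (hs : Ok s) (hv : s (v, true) = []) :
    Runs (iter v P) s ((s (v, false)).length * (c + 5) + 3)
      (update s a (F^[(s (v, false)).length] (s a))) := by
  have hne : ∀ b, a ≠ (v, b) := fun b h => ha (by rw [h])
  have step : ∀ (l : List (G v)) (s : ∀ p : B × Bool, List (G p.1)), Ok s → s (v, false) = l →
      Runs (drain (v, false) fun a => seq (push (v, true) a) P) s (l.length * (c + 3) + 1)
        (update (update (update s (v, false) []) (v, true) (l.reverse ++ s (v, true))) a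
          (F^[l.length] (s a))) := by
    intro l
    induction l with
    | nil =>
      intro s hs hl
      have : update (update (update s (v, false) []) (v, true)
          (([] : List (G v)).reverse ++ s (v, true))) a (F^[0] (s a)) = s := by
        funext p
        by_cases h1 : p = a
        · subst h1; simp
        · by_cases h2 : p = (v, true)
          · subst h2; simp [h1]
          · by_cases h3 : p = (v, false)
            · subst h3; simp [h1, hl]
            · simp [h1, h2, h3]
      simp only [List.length_nil]
      rw [this]
      exact .drainNil hl (by simp)
    | cons x l ih =>
      intro s hs hl
      have h1 := hP (update (update s (v, false) l) (v, true) (x :: s (v, true)))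
        (hOk _ _ _ (hOk _ _ _ hs))
      have h2 := ih _ (hOk' _ (F (update (update s (v, false) l) (v, true)
        (x :: s (v, true)) a)) (hOk _ true (x :: s (v, true)) (hOk _ false l hs)))
        (by rw [update_of_ne (hne _).symm, update_of_ne (by simp), update_self])
      have h0 : Runs (push (v, true) x) (update s (v, false) l) 1
          (update (update s (v, false) l) (v, true) (x :: s (v, true))) := by
        have := Runs.push (k := (v, true)) (a := x) (s := update s (v, false) l) le_rfl
        rwa [update_of_ne (by simp)] at this
      refine (cast ?_ (Runs.drainCons hl (.seq h0 h1 le_rfl) h2 le_rfl))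
      congr 1
      · simp; ring
      · funext p
        by_cases h1 : p = a
        · subst h1; simp [hne]
        · rw [update_of_ne h1, update_of_ne h1]
          by_cases h2 : p = (v, true)
          · subst h2; simp [(hne _).symm]
          · by_cases h3 : p = (v, false)
            · subst h3; simp
            · simp [h1, h2, h3]
  have h1 := step _ s hs rfl
  have h2 := restore_runs v (update (update (update s (v, false) []) (v, true)
    ((s (v, false)).reverse ++ s (v, true))) a (F^[(s (v, false)).length] (s a)))
  refine (cast ?_ (Runs.seq h1 (h2.mono (t' := 2 * (s (v, false)).length + 1) ?_)
    (t := (s (v, false)).length * (c + 5) + 3) ?_))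
  · congr 1
    funext p
    by_cases h1 : p = a
    · subst h1; simp [hne]
    · by_cases h2 : p = (v, true)
      · subst h2; simp [(hne _).symm, hv]
      · by_cases h3 : p = (v, false)
        · subst h3; simp [(hne _).symm, hv]
        · simp [h1, h2, h3]
  · simp [(hne _).symm, hv]
  · nlinarith

theorem shift_runs {v k : B} (hvk : v ≠ k) (s : ∀ p : B × Bool, List (G p.1)) :
    Runs (shift v k) s (5 * (s (v, false)).length + 1)
      (update (update (update (update s (v, false) []) (v, true)
        ((s (v, false)).reverse ++ s (v, true)))
        (k, false) ((s (k, false)).drop (s (v, false)).length))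
        (k, true) (((s (k, false)).take (s (v, false)).length).reverse ++ s (k, true))) := by
  generalize hl : s (v, false) = l
  induction l generalizing s with
  | nil =>
    refine cast ?_ (Runs.drainNil (k := (v, false)) (s := s)
      (f := fun a => seq (push (v, true) a)
        (pop (k, false) fun o => o.elim skip fun b => push (k, true) b)) hl
      (t := 5 * ([] : List (G v)).length + 1) (by simp))
    rw [shift]
    congr 1
    funext p
    by_cases h1 : p = (k, true)
    · subst h1; simp
    · by_cases h4 : p = (k, false)
      · subst h4; simp
      · by_cases h2 : p = (v, true)
        · subst h2; simp [hvk]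
        · by_cases h3 : p = (v, false)
          · subst h3; simp [hvk, hl]
          · simp [h1, h2, h3, h4]
  | cons x l ih =>
    have hkv : k ≠ v := hvk.symm
    obtain ⟨s1, hs1⟩ : ∃ s1, s1 = update (update s (v, false) l) (v, true) (x :: s (v, true)) :=
      ⟨_, rfl⟩
    have h0 : Runs (push (v, true) x) (update s (v, false) l) 1 s1 := by
      have := Runs.push (k := (v, true)) (a := x) (s := update s (v, false) l) le_rfl
      rwa [update_of_ne (by simp), ← hs1] at this
    have hk : s1 (k, false) = s (k, false) := by simp [hs1, hkv]
    have hk' : s1 (k, true) = s (k, true) := by simp [hs1, hkv]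
    have h1 : Runs (pop (k, false) fun o => o.elim skip fun b => push (k, true) b) s1 2
        (update (update s1 (k, false) ((s (k, false)).drop 1)) (k, true)
          (((s (k, false)).take 1).reverse ++ s (k, true))) := by
      rw [← hk, ← hk']
      cases hs : s1 (k, false) with
      | nil =>
        refine .popNil (n := 1) hs ?_ le_rfl
        have : update (update s1 (k, false) (List.drop 1 [])) (k, true)
            ((List.take 1 []).reverse ++ s1 (k, true)) = s1 := by
          simp [(update_eq_self_iff (f := s1) (a := (k, false))).2 hs.symm]
        rw [this]
        exact .skip le_rfl
      | cons b l' =>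
        refine .popCons (n := 1) hs ?_ le_rfl
        have h := Runs.push (Γ := fun p : B × Bool => G p.1) (k := (k, true)) (a := b)
          (s := update s1 (k, false) l') le_rfl
        rwa [update_of_ne (by simp)] at h
    have h2 := ih (update (update s1 (k, false) ((s (k, false)).drop 1)) (k, true)
          (((s (k, false)).take 1).reverse ++ s (k, true))) (by simp [hvk, hs1])
    refine cast ?_ (Runs.drainCons hl (.seq h0 h1 le_rfl) h2 le_rfl)
    congr 1
    · simp; ring
    · funext p
      by_cases h1 : p = (k, true)
      · subst h1
        cases s (k, false) <;> simp
      · rw [update_of_ne h1, update_of_ne h1]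
        by_cases h4 : p = (k, false)
        · subst h4; cases s (k, false) <;> simp
        · rw [update_of_ne h4, update_of_ne h4]
          by_cases h2 : p = (v, true)
          · subst h2; simp [hvk, hs1]
          · by_cases h3 : p = (v, false)
            · subst h3; simp
            · simp [h1, h2, h3, h4, hs1]

/-- If the index is out of range, then the old value is `none` and nothing is written. -/
theorem access_runs {v k : B} (hvk : v ≠ k) {w : G k → G k}
    {f : Option (G k) → Prog fun p : B × Bool => G p.1} {s s' : ∀ p : B × Bool, List (G p.1)}
    {n : ℕ} (hv : s (v, true) = []) (hk : s (k, true) = [])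
    (hf : Runs (f (s (k, false))[(s (v, false)).length]?)
      (update s (k, false) ((s (k, false)).modify (s (v, false)).length w)) n s') :
    Runs (access v k w f) s (n + 9 * (s (v, false)).length + 10) s' := by
  have hkv : k ≠ v := hvk.symm
  have h1 := shift_runs hvk s
  set i := (s (v, false)).length with hi
  set s1 := update (update (update (update s (v, false) []) (v, true)
        ((s (v, false)).reverse ++ s (v, true)))
        (k, false) ((s (k, false)).drop i))
        (k, true) (((s (k, false)).take i).reverse ++ s (k, true)) with hs1
  have e1 : s1 (k, false) = (s (k, false)).drop i := by simp [hs1]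
  -- the common part of the two cases, after the entry has been written
  have main : ∀ s2 : ∀ p : B × Bool, List (G p.1), s2 = update s1 (k, false)
      (((s (k, false)).drop i).modifyHead w) →
      Runs (seq (restore k) (seq (restore v) (f (s (k, false))[i]?))) s2 (n + 4 * i + 5) s' := by
    intro s2 hs2
    have r1 := restore_runs k s2
    have e2 : s2 (k, true) = ((s (k, false)).take i).reverse := by simp [hs2, hs1, hk]
    rw [e2] at r1
    set s3 := update (update s2 (k, true) []) (k, false)
      (((s (k, false)).take i).reverse.reverse ++ s2 (k, false)) with hs3
    have r2 := restore_runs v s3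
    have e3 : s3 (v, true) = (s (v, false)).reverse := by simp [hs3, hs2, hs1, hvk, hv]
    rw [e3] at r2
    refine .seq r1 (.seq r2 (m := n) (cast ?_ hf) (le_refl _)) ?_
    · congr 1
      funext p
      by_cases h1 : p = (v, false)
      · subst h1; simp [hs3, hs2, hs1, hvk]
      · rw [update_of_ne h1]
        by_cases h2 : p = (v, true)
        · subst h2; simp [hvk, hv]
        · rw [update_of_ne h2, hs3]
          by_cases h3 : p = (k, false)
          · subst h3
            simp [hs2, List.modify_eq_take_drop]
          · by_cases h4 : p = (k, true)
            · subst h4; simp [hk]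
            · simp [hs2, hs1, h1, h2, h3, h4]
    · simp only [List.length_reverse, List.length_take, ← hi]
      omega
  cases hd : (s (k, false)).drop i with
  | nil =>
    have ho : (s (k, false))[i]? = none := by
      rw [← List.head?_drop, hd]; rfl
    refine .seq h1 (.popNil (n := n + 4 * i + 7) (e1.trans hd)
      (.seq (m := n + 4 * i + 5) (.skip le_rfl) ?_ (by omega)) le_rfl) ?_ (m := n + 4 * i + 8)
    · rw [← ho]
      refine main _ ?_
      simp [hd, ← hd.symm.trans e1.symm]
    · omega
  | cons b l =>
    have ho : (s (k, false))[i]? = some b := by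
      rw [← List.head?_drop, hd]; rfl
    refine .seq h1 (.popCons (n := n + 4 * i + 7) (e1.trans hd)
      (.seq (m := n + 4 * i + 5) (.push le_rfl) ?_ (by omega)) le_rfl) ?_ (m := n + 4 * i + 8)
    · rw [← ho]
      refine main _ ?_
      simp [hd]
    · omega

end Prog

/-! ### A language of loops over a table -/

/-- The stacks of the machine: the input, the state of the transducer that reads it, the array of
cells that the transducer produces, a square table of booleans (row by row), the output, the length
of the array, an address in the table, and the loop variables. Numbers are kept in unary. -/
inductive Reg : Type
  | inp | mealy | cells | table | out | size | addr
  | var (v : Fin 6)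
  deriving DecidableEq, Fintype

/-- The symbols on the stacks. -/
abbrev Reg.Sym (I Q C O : Type) : Reg → Type
  | inp => I
  | mealy => Q
  | cells => C
  | table => Bool
  | out => O
  | _ => Unit

/-- Programs that work on a fixed array of cells and a table whose rows and columns are indexed by
the positions in the array. -/
inductive Cmd (C O : Type) : Type
  /-- Do nothing. -/
  | skip : Cmd C O
  /-- Run two programs one after the other. -/
  | seq (P Q : Cmd C O) : Cmd C O
  /-- Run `P` for all values of `v` below the length of the array, in decreasing order. -/
  | loop (v : Fin 6) (P : Cmd C O) : Cmd C O
  /-- Read the cell at position `v`. -/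
  | read (v : Fin 6) (f : C → Cmd C O) : Cmd C O
  /-- Run `P` if the table is marked at `(v, w)`. -/
  | test (v w : Fin 6) (P : Cmd C O) : Cmd C O
  /-- Mark the table at `(v, w)`, or at `(v, w + 1)` if `b` is true. -/
  | mark (v w : Fin 6) (b : Bool) : Cmd C O
  /-- Put a symbol in front of the output. -/
  | emit (o : O) : Cmd C O
  /-- Put `v` copies of a symbol in front of the output. -/
  | emitVar (v : Fin 6) (o : O) : Cmd C O
  /-- Add an unmarked entry to the table. -/
  | grow : Cmd C O

namespace Cmd

variable {I Q C O : Type}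

/-- The effect of a program on the table and the output, when the array is `cs` and the values of
the variables are given by `env`. -/
def eval (cs : List C) : Cmd C O → (Fin 6 → ℕ) → List Bool × List O → List Bool × List O
  | skip, _, st => st
  | seq P Q, env, st => Q.eval cs env (P.eval cs env st)
  | loop v P, env, st =>
      (List.range cs.length).foldr (fun i st => P.eval cs (update env v i) st) st
  | read v f, env, st => match cs[env v]? with
    | none => st
    | some c => (f c).eval cs env st
  | test v w P, env, st =>
      if st.1[env v * cs.length + env w]? = some true then P.eval cs env st else st
  | mark v w b, env, st => (st.1.set (env v * cs.length + env w + b.toNat) true, st.2)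
  | emit o, _, st => (st.1, o :: st.2)
  | emitVar v o, env, st => (st.1, List.replicate (env v) o ++ st.2)
  | grow, _, st => (false :: st.1, st.2)

/-- The loops of the program use the variables in order: a loop in the scope of `d` other loops
uses the variable `d`. -/
def Scoped : Cmd C O → ℕ → Prop
  | seq P Q, d => P.Scoped d ∧ Q.Scoped d
  | loop v P, d => v.val = d ∧ P.Scoped (d + 1)
  | read _ f, d => ∀ c, (f c).Scoped d
  | test _ _ P, d => P.Scoped d
  | _, _ => True

/-- The contents of the stacks during the execution of a program. -/
def mem (I Q : Type) {C O : Type} (cs : List C) (env : Fin 6 → ℕ) (st : List Bool × List O) :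
    ∀ p : Reg × Bool, List (Reg.Sym I Q C O p.1)
  | (_, true) => []
  | (k, false) => match k with
    | .cells => cs
    | .table => st.1
    | .out => st.2
    | .size => List.replicate cs.length ()
    | .var v => List.replicate (env v) ()
    | .inp => []
    | .mealy => []
    | .addr => []

open Prog

/-- Put the position of the entry `(v, w)`, or `(v, w + 1)`, of the table on the address stack. -/
def locate (v w : Fin 6) (b : Bool) : Prog fun p : Reg × Bool => Reg.Sym I Q C O p.1 :=
  .seq (iter (.var v) (iter .size (.push (.addr, false) ())))
    (.seq (iter (.var w) (.push (.addr, false) ()))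
      (bif b then .push (.addr, false) () else .skip))

/-- The translation to a program on stacks. -/
def compile : Cmd C O → Prog fun p : Reg × Bool => Reg.Sym I Q C O p.1
  | skip => .skip
  | seq P Q => .seq P.compile Q.compile
  | loop v P => .seq (iter .size (.push (.var v, false) ()))
      (.drain (.var v, false) fun _ => P.compile)
  | read v f => access (.var v) .cells id fun o => match o with
    | none => .skip
    | some c => (f c).compile
  | test v w P => .seq (locate v w false) (access .addr .table id fun o =>
      .seq (.drain (.addr, false) fun _ => .skip) (match o with
        | some true => P.compile
        | _ => .skip))
  | mark v w b => .seq (locate v w b) (access .addr .table (fun _ => true) fun _ =>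
      .drain (.addr, false) fun _ => .skip)
  | emit o => .push (.out, false) o
  | emitVar v o => iter (.var v) (.push (.out, false) o)
  | grow => .push (.table, false) false

variable (cs : List C) (env : Fin 6 → ℕ) (st : List Bool × List O)

theorem update_mem_var (v : Fin 6) (n : ℕ) :
    update (mem I Q cs env st) (.var v, false) (List.replicate n ()) =
      mem I Q cs (update env v n) st := by
  funext p
  by_cases h : p = (.var v, false)
  · subst h; simp [mem]
  · rw [update_of_ne h]
    obtain ⟨k, b⟩ := p
    cases b with
    | true => rfl
    | false =>
      cases k with
      | var w =>
        have : w ≠ v := fun e => h (by rw [e])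
        simp [mem, this]
      | _ => rfl

theorem update_mem_table (t : List Bool) :
    update (mem I Q cs env st) (.table, false) t = mem I Q cs env (t, st.2) := by
  funext p
  by_cases h : p = (.table, false)
  · subst h; simp [mem]
  · rw [update_of_ne h]
    obtain ⟨k, b⟩ := p
    cases b with
    | true => rfl
    | false =>
      cases k with
      | table => exact absurd rfl h
      | _ => rfl

theorem update_mem_out (o : List O) :
    update (mem I Q cs env st) (.out, false) o = mem I Q cs env (st.1, o) := by
  funext p
  by_cases h : p = (.out, false)
  · subst h; simp [mem]
  · rw [update_of_ne h]
    obtain ⟨k, b⟩ := p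
    cases b with
    | true => rfl
    | false =>
      cases k with
      | out => exact absurd rfl h
      | _ => rfl

theorem iterate_cons {α : Type} (a : α) (n : ℕ) (l : List α) :
    (List.cons a)^[n] l = List.replicate n a ++ l := by
  induction n with
  | zero => rfl
  | succ n ih => rw [Function.iterate_succ_apply', ih]; rfl

theorem clear_runs {K : Type} [DecidableEq K] {Γ : K → Type} (k : K) (s : ∀ k, List (Γ k)) :
    Runs (.drain k fun _ => .skip) s (2 * (s k).length + 1) (update s k []) := by
  generalize hl : s k = l
  induction l generalizing s with
  | nil =>
    rw [← hl, update_eq_self]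
    exact .drainNil hl (by simp)
  | cons a l ih =>
    have := ih (update s k l) (by simp)
    rw [update_idem] at this
    exact .drainCons hl (.skip le_rfl) this (by simp; omega)

theorem iter_push_runs {B : Type} [DecidableEq B] {G : B → Type} {v : B} {k : B × Bool}
    (hk : k.1 ≠ v) (a : G k.1) (s : ∀ p : B × Bool, List (G p.1)) (hv : s (v, true) = []) :
    Runs (iter v (.push k a)) s ((s (v, false)).length * 6 + 3)
      (update s k (List.replicate (s (v, false)).length a ++ s k)) := by
  have := iter_runs (v := v) (P := .push k a) hk (F := List.cons a) (c := 1)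
    (Ok := fun _ => True) (fun _ _ _ _ => trivial) (fun _ _ _ => trivial)
    (fun s _ => Runs.push le_rfl) s trivial hv
  rwa [iterate_cons] at this

theorem locate_runs (v w : Fin 6) (b : Bool) (hv : env v ≤ cs.length) (hw : env w ≤ cs.length) :
    Runs (locate v w b) (mem I Q cs env st) (cs.length * (cs.length * 6 + 8) + cs.length * 6 + 9)
      (update (mem I Q cs env st) (.addr, false)
        (List.replicate (env v * cs.length + env w + b.toNat) ())) := by
  have h1 := iter_runs (G := Reg.Sym I Q C O) (v := .var v)
    (P := iter .size (.push (.addr, false) ()))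
    (a := (.addr, false)) (by simp) (F := (List.cons ())^[cs.length]) (c := cs.length * 6 + 3)
    (Ok := fun s => s (.size, false) = List.replicate cs.length () ∧ s (.size, true) = [])
    (fun s b l h => by simpa using h) (fun s l h => by simpa using h)
    (fun s hs => by
      have := iter_push_runs (G := Reg.Sym I Q C O) (v := .size) (k := (.addr, false)) (by simp) ()
        s hs.2
      rw [hs.1, List.length_replicate, ← iterate_cons] at this
      exact this)
    (mem I Q cs env st) ⟨rfl, rfl⟩ rfl
  have e1 : (mem I Q cs env st (.var v, false)).length = env v := List.length_replicate
  have e2 : (mem I Q cs env st (.addr, false)) = [] := rfl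
  rw [e1, e2, ← Function.iterate_mul, iterate_cons, List.append_nil] at h1
  have h2 := iter_push_runs (G := Reg.Sym I Q C O) (v := .var w) (k := (.addr, false)) (by simp) ()
    (update (mem I Q cs env st) (.addr, false) (List.replicate (cs.length * env v) ()))
    (by simp [mem])
  rw [update_self, update_of_ne (by simp), update_idem] at h2
  have e3 : (mem I Q cs env st (.var w, false)).length = env w := List.length_replicate
  rw [e3, ← List.replicate_add] at h2
  have hm1 : env v * (cs.length * 6 + 3 + 5) ≤ cs.length * (cs.length * 6 + 8) := by gcongr
  have hm2 : env w * 6 ≤ cs.length * 6 := by gcongr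
  refine .seq h1 (.seq h2 (m := 1) ?_ le_rfl) (by omega)
  cases b with
  | false =>
    have : env v * cs.length + env w + false.toNat = env w + cs.length * env v := by
      simp; ring
    rw [this]
    exact .skip le_rfl
  | true =>
    have : env v * cs.length + env w + true.toNat = env w + cs.length * env v + 1 := by
      simp; ring
    rw [this, List.replicate_succ]
    have h := Runs.push (Γ := fun p : Reg × Bool => Reg.Sym I Q C O p.1) (k := (.addr, false))
      (a := ()) (s := update (mem I Q cs env st) (.addr, false)
        (List.replicate (env w + cs.length * env v) ())) le_rfl
    rw [update_self, update_idem] at h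
    exact h

/-- The translation of a program has the effect of the program, and its running time is bounded by
a polynomial in the length of the array. The variables of the loops of `P` have to be `0` initially,
because a loop adds the length of the array to the height of the stack of its variable. -/
theorem compile_runs [Finite C] (P : Cmd C O) (d : ℕ) (hP : P.Scoped d) :
    ∃ p : Polynomial ℕ, ∀ (cs : List C) (env : Fin 6 → ℕ) (st : List Bool × List O),
      (∀ v, env v ≤ cs.length) → (∀ v : Fin 6, d ≤ v.val → env v = 0) →
      Runs P.compile (mem I Q cs env st) (p.eval cs.length)
        (mem I Q cs env (P.eval cs env st)) := by
  induction P generalizing d with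
  | skip => exact ⟨1, fun cs env st _ _ => .skip (by simp)⟩
  | seq P Q ihP ihQ =>
    obtain ⟨p, hp⟩ := ihP d hP.1
    obtain ⟨q, hq⟩ := ihQ d hP.2
    exact ⟨p + q + 1, fun cs env st h1 h2 =>
      .seq (hp cs env st h1 h2) (hq cs env _ h1 h2) (by simp)⟩
  | loop v P ih =>
    obtain ⟨p, hp⟩ := ih (d + 1) hP.2
    refine ⟨.X * 6 + 3 + (.X * (p + 1) + 1) + 1, fun cs env st h1 h2 => ?_⟩
    have hv : env v = 0 := h2 v hP.1.ge
    have r1 := iter_push_runs (G := Reg.Sym I Q C O) (v := .size) (k := (.var v, false)) (by simp)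
      () (mem I Q cs env st) rfl
    have e1 : (mem I Q cs env st (.size, false)).length = cs.length := List.length_replicate
    have e2 : (mem I Q cs env st (.var v, false)) = [] := by
      change List.replicate (env v) () = []
      rw [hv]; rfl
    rw [e1, e2, List.append_nil, update_mem_var] at r1
    have r2 : ∀ (n : ℕ) (st : List Bool × List O), n ≤ cs.length →
        Runs (.drain (.var v, false) fun _ => P.compile) (mem I Q cs (update env v n) st)
          (n * (p.eval cs.length + 1) + 1) (mem I Q cs env
            ((List.range n).foldr (fun i st => P.eval cs (update env v i) st) st)) := by
      intro n
      induction n with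
      | zero =>
        intro st _
        have : update env v 0 = env := by rw [← hv, update_eq_self]
        rw [this]
        exact .drainNil e2 (by simp)
      | succ n ihn =>
        intro st hn
        have r3 := hp cs (update env v n) st
          (fun w => by
            by_cases hw : w = v
            · subst hw; simp; omega
            · simp [hw, h1])
          (fun w hw => by
            have : w ≠ v := fun h => by subst h; have := hP.1; omega
            simp [this, h2 w (by omega)])
        refine .drainCons (a := ()) (l := List.replicate n ())
          (by simp [mem, List.replicate_succ]) ?_
          (ihn (P.eval cs (update env v n) st) (by omega) |> (cast ?_ ·))
          (n := p.eval cs.length) (m := n * (p.eval cs.length + 1) + 1) (by ring_nf; rfl)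
          (s' := mem I Q cs (update env v n) (P.eval cs (update env v n) st))
        · rw [update_mem_var, update_idem]
          exact r3
        · rw [List.range_succ, List.foldr_append]
          rfl
    refine .seq r1 (r2 cs.length st le_rfl) ?_
    simp
  | read v f ih =>
    choose p hp using fun c => ih c d (hP c)
    have := Fintype.ofFinite C
    refine ⟨1 + ∑ c, p c + 9 * .X + 10, fun cs env st h1 h2 => ?_⟩
    have hn : (mem I Q cs env st (.var v, false)).length = env v := List.length_replicate
    rw [compile]
    refine (access_runs (G := Reg.Sym I Q C O) (v := .var v) (k := .cells) (s := mem I Q cs env st)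
      (n := 1 + ∑ c, (p c).eval cs.length) (by simp) rfl rfl ?_).mono ?_
    · rw [hn]
      have hc : mem I Q cs env st (.cells, false) = cs := rfl
      have hs : update (mem I Q cs env st) (.cells, false)
          ((mem I Q cs env st (.cells, false)).modify (env v) id) = mem I Q cs env st := by
        rw [List.modify_id, update_eq_self]
      rw [hs]
      simp only [eval, hc]
      cases h : cs[env v]? with
      | none => exact .skip (by omega)
      | some c =>
        refine (hp c cs env st h1 h2).mono ?_
        have := Finset.single_le_sum (f := fun c => (p c).eval cs.length)
          (fun _ _ => Nat.zero_le _) (Finset.mem_univ c)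
        exact this.trans (by omega)
    · rw [hn]
      have := h1 v
      simp [Polynomial.eval_finsetSum]
      omega
  | test v w P ih =>
    obtain ⟨p, hp⟩ := ih d hP
    refine ⟨.X * (.X * 6 + 8) + .X * 6 + 9 +
      ((2 * (.X * .X + .X) + 1 + (p + 1) + 1) + 9 * (.X * .X + .X) + 10) + 1,
      fun cs env st h1 h2 => ?_⟩
    have r1 := locate_runs (I := I) (Q := Q) cs env st v w false (h1 v) (h1 w)
    simp only [Bool.toNat_false, add_zero] at r1
    set i := env v * cs.length + env w with hi
    have hile : i ≤ cs.length * cs.length + cs.length := by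
      have := Nat.mul_le_mul_right cs.length (h1 v)
      have := h1 w
      omega
    set s := update (mem I Q cs env st) (.addr, false) (List.replicate i ()) with hs
    have hlen : (s (.addr, false)).length = i := by simp [hs]
    have ht : s (.table, false) = st.1 := rfl
    have r2 : Runs (.drain (.addr, false) fun _ => .skip) s (2 * i + 1) (mem I Q cs env st) := by
      have := clear_runs (.addr, false) s
      rw [hlen, hs, update_idem] at this
      have e : (mem I Q cs env st (.addr, false)) = [] := rfl
      rwa [← e, update_eq_self] at this
    refine .seq r1 (m := (2 * i + 1 + (p.eval cs.length + 1) + 1) + 9 * i + 10) ?_ ?_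
    · rw [← hlen]
      refine access_runs (G := Reg.Sym I Q C O) (by simp) rfl rfl ?_
      rw [hlen, List.modify_id, update_eq_self]
      refine .seq r2 (m := p.eval cs.length + 1) ?_ le_rfl
      rw [ht, eval]
      split
      · rename_i h
        rw [if_pos (h ▸ rfl)]
        exact (hp cs env st h1 h2).mono (by omega)
      · rename_i h
        rw [if_neg (fun h' => h h')]
        exact .skip (by omega)
    · simp
      omega
  | mark v w b =>
    refine ⟨.X * (.X * 6 + 8) + .X * 6 + 9 +
      ((2 * (.X * .X + .X + 1) + 1) + 9 * (.X * .X + .X + 1) + 10) + 1,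
      fun cs env st h1 h2 => ?_⟩
    have r1 := locate_runs (I := I) (Q := Q) cs env st v w b (h1 v) (h1 w)
    set i := env v * cs.length + env w + b.toNat with hi
    have hile : i ≤ cs.length * cs.length + cs.length + 1 := by
      have := Nat.mul_le_mul_right cs.length (h1 v)
      have := h1 w
      have := b.toNat_le
      omega
    set s := update (mem I Q cs env st) (.addr, false) (List.replicate i ()) with hs
    have hlen : (s (.addr, false)).length = i := by simp [hs]
    have ht : s (.table, false) = st.1 := rfl
    refine .seq r1 (m := (2 * i + 1) + 9 * i + 10) ?_ ?_
    · rw [← hlen]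
      refine access_runs (G := Reg.Sym I Q C O) (by simp) rfl rfl ?_
      rw [hlen, ht]
      have h := clear_runs (Γ := fun p : Reg × Bool => Reg.Sym I Q C O p.1) (.addr, false)
        (update s (.table, false) (st.1.modify i fun _ => true))
      have e : update s (.table, false) (st.1.modify i fun _ => true) (.addr, false) =
        s (.addr, false) := rfl
      rw [e, hlen, update_comm (by simp), update_idem]  at h
      have e : (mem I Q cs env (st.1.modify i fun _ => true, st.2) (.addr, false)) = [] := rfl
      rw [update_mem_table, ← e, update_eq_self] at h
      refine cast ?_ h
      rw [eval, List.set_eq_modify, hs, update_comm (by simp), update_mem_table]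
    · simp
      omega
  | emit o =>
    refine ⟨1, fun cs env st _ _ => ?_⟩
    have h := Runs.push (Γ := fun p : Reg × Bool => Reg.Sym I Q C O p.1) (k := (.out, false))
      (a := o) (s := mem I Q cs env st) (t := 1) le_rfl
    have e : mem I Q cs env st (.out, false) = st.2 := rfl
    rw [e, update_mem_out] at h
    rw [Polynomial.eval_one]
    exact h
  | emitVar v o =>
    refine ⟨.X * 6 + 3, fun cs env st h1 _ => ?_⟩
    have h := iter_push_runs (G := Reg.Sym I Q C O) (v := .var v) (k := (.out, false)) (by simp)
      o (mem I Q cs env st) rfl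
    have e : mem I Q cs env st (.out, false) = st.2 := rfl
    have e1 : (mem I Q cs env st (.var v, false)).length = env v := List.length_replicate
    rw [e, e1, update_mem_out] at h
    refine h.mono ?_
    have := h1 v
    simp
    omega
  | grow =>
    refine ⟨1, fun cs env st _ _ => ?_⟩
    have h := Runs.push (Γ := fun p : Reg × Bool => Reg.Sym I Q C O p.1) (k := (.table, false))
      (a := false) (s := mem I Q cs env st) (t := 1) le_rfl
    have e : mem I Q cs env st (.table, false) = st.1 := rfl
    rw [e, update_mem_table] at h
    rw [Polynomial.eval_one]
    exact h

end Cmd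

/-! ### The pushdown system of a keyboard -/

/-- The actions that are written in the cells: those of the letters and the backspace, the end of
a transient key, the end of a final key, and a separator. -/
inductive Act (A : Type) : Type
  | letter (a : A)
  | back
  | endTransient
  | endFinal
  | sep

/-- A cell consists of an action, and of a flag that tells whether it is the first one of a key. -/
abbrev Cell (A : Type) : Type := Bool × Act A

variable {A : Type}

/-- The action of an operation; the arrows are ignored. -/
def Op.toAct : Op A → Act A
  | .letter a => .letter a
  | .backspace => .back
  | _ => .sep

/-- The end marker of a final key (`b = true`) or a transient key (`b = false`). -/
def Act.ofEnd (A : Type) (b : Bool) : Act A := bif b then .endFinal else .endTransient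

/-- The effect of an action on the word before the cursor. -/
def Act.run (u : List A) : Act A → List A
  | .letter a => u ++ [a]
  | .back => u.dropLast
  | _ => u

/-- The cell that replaces an input symbol. The state of the transducer tells whether the final
keys have been reached, and whether a key begins. -/
def cellOf (q : Bool × Bool) : InSymbol A → Cell A
  | .op σ => (q.2, σ.toAct)
  | .endKey => (q.2, .ofEnd A q.1)
  | .endTransient => (q.2, .sep)

/-- The transitions of the transducer. -/
def nextState (q : Bool × Bool) : InSymbol A → Bool × Bool
  | .op _ => (q.1, false)
  | .endKey => (q.1, true)
  | .endTransient => (true, true)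

/-- The transducer that replaces input symbols by cells. -/
def annotate : Bool × Bool → List (InSymbol A) → List (Cell A)
  | _, [] => []
  | q, x :: l => cellOf q x :: annotate (nextState q x) l

/-- The state in which the cell at position `i` is executed. All keys begin in the state `0`. -/
def src (start : Bool) (i : ℕ) : ℕ := bif start then 0 else i

/-- The moves of the pushdown system given by an array of cells. Its states are the positions in the
array. Executing the cell at position `i` leads to position `i + 1`, except that the end of a
transient key leads back to `0`, where another key can begin. -/
inductive Move (cs : List (Cell A)) : ℕ × List A → ℕ × List A → Prop
  | letter {i s a} (u : List A) : cs[i]? = some (s, .letter a) →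
      Move cs (src s i, u) (i + 1, u ++ [a])
  | back {i s} (u : List A) : cs[i]? = some (s, .back) → Move cs (src s i, u) (i + 1, u.dropLast)
  | endTransient {i s} (u : List A) : cs[i]? = some (s, .endTransient) →
      Move cs (src s i, u) (0, u)

/-- If the cell at position `p` is a letter, then `Rel cs p q` says that after executing it, the
system can reach the state `q` with the same stack, without ever going below it. If it is a
separator, then `Rel cs p q` says that the state `q` can be reached with an empty stack from the
initial state with an empty stack. -/
inductive Rel (cs : List (Cell A)) : ℕ → ℕ → Prop
  | letter {p s a} : cs[p]? = some (s, .letter a) → Rel cs p (p + 1)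
  | sep {p s} : cs[p]? = some (s, .sep) → Rel cs p 0
  | bottom {p s r s'} : cs[p]? = some (s, .sep) → cs[r]? = some (s', .back) →
      Rel cs p (src s' r) → Rel cs p (r + 1)
  | endTransient {p r s} : cs[r]? = some (s, .endTransient) → Rel cs p (src s r) → Rel cs p 0
  | pop {p q r s a s'} : cs[q]? = some (s, .letter a) → cs[r]? = some (s', .back) →
      Rel cs p (src s q) → Rel cs q (src s' r) → Rel cs p (r + 1)

open Relation

/-- The summarised runs above a pushed letter are possible on top of every stack `u`. -/
theorem Rel.sound_letter {cs : List (Cell A)} {p q : ℕ} (h : Rel cs p q) {s : Bool} {a : A}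
    (hp : cs[p]? = some (s, .letter a)) (u : List A) :
    ReflTransGen (Move cs) (p + 1, u) (q, u) := by
  induction h generalizing s a u with
  | letter _ => exact .refl
  | sep h => simp [h] at hp
  | bottom h => simp [h] at hp
  | endTransient h _ ih => exact (ih hp u).tail (.endTransient u h)
  | @pop p q r s' b s'' hq hr _ _ ih1 ih2 =>
    have h1 := ((ih1 hp u).tail (.letter u hq)).trans (ih2 hq (u ++ [b]))
    have h2 := h1.tail (.back _ hr)
    rwa [List.dropLast_concat] at h2

/-- The summarised runs at the bottom of the stack are possible. -/
theorem Rel.sound_sep {cs : List (Cell A)} {p q : ℕ} (h : Rel cs p q) {s : Bool}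
    (hp : cs[p]? = some (s, .sep)) : ReflTransGen (Move cs) (0, []) (q, []) := by
  induction h generalizing s with
  | letter h => simp [h] at hp
  | sep _ => exact .refl
  | bottom _ h _ ih => exact (ih hp).tail (.back [] h)
  | endTransient h _ ih => exact (ih hp).tail (.endTransient [] h)
  | @pop p q r s' b s'' hq hr _ h ih1 _ =>
    have h1 := ((ih1 hp).tail (.letter [] hq)).trans (h.sound_letter hq ([] ++ [b]))
    have h2 := h1.tail (.back _ hr)
    rwa [List.dropLast_concat] at h2

/-- The initial states: the positions of the separators. -/
def startStates (cs : List (Cell A)) : List (Fin cs.length) :=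
  (List.finRange cs.length).flatMap fun p => match cs[p.val] with
    | (_, .sep) => [p]
    | _ => []

open Classical in
/-- The accepting states: those from which a final key can be completed. -/
noncomputable def acceptStates (cs : List (Cell A)) : List (Fin cs.length) :=
  (List.finRange cs.length).flatMap fun p => (List.finRange cs.length).flatMap fun i =>
    match cs[i.val] with
    | (s, .endFinal) => if Rel cs p (src s i) then [p] else []
    | _ => []

open Classical in
/-- The transitions: there is one from `p` to `q` if the letter at `q` can be written on top of
the letter at `p`. -/
noncomputable def transitions (cs : List (Cell A)) : List (Fin cs.length × A × Fin cs.length) :=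
  (List.finRange cs.length).flatMap fun p => (List.finRange cs.length).flatMap fun q =>
    match cs[q.val] with
    | (s, .letter a) => if Rel cs p (src s q) then [(p, a, q)] else []
    | _ => []

/-- The automaton that reads the stack of the pushdown system from the bottom to the top. Its
state is the position of the letter cell that has written the last letter, and initially the
position of a separator. -/
noncomputable def automaton (cs : List (Cell A)) : ListedNFA A where
  numStates := cs.length
  start := startStates cs
  accept := acceptStates cs
  trans := transitions cs

theorem mem_startStates {cs : List (Cell A)} {p : Fin cs.length} :
    p ∈ startStates cs ↔ ∃ s, cs[p.val]? = some (s, .sep) := by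
  simp only [startStates, List.mem_flatMap, List.mem_finRange, true_and]
  constructor
  · rintro ⟨q, h⟩
    split at h
    · rename_i s hs
      obtain rfl := List.mem_singleton.1 h
      exact ⟨s, by simp [hs]⟩
    · simp at h
  · rintro ⟨s, h⟩
    obtain ⟨hi, h⟩ := List.getElem?_eq_some_iff.1 h
    exact ⟨p, by simp [h]⟩

theorem mem_acceptStates {cs : List (Cell A)} {p : Fin cs.length} :
    p ∈ acceptStates cs ↔
      ∃ (i : ℕ) (s : Bool), cs[i]? = some (s, .endFinal) ∧ Rel cs p (src s i) := by
  simp only [acceptStates, List.mem_flatMap, List.mem_finRange, true_and]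
  constructor
  · rintro ⟨q, i, h⟩
    split at h
    · rename_i s hs
      split_ifs at h with hr
      · obtain rfl := List.mem_singleton.1 h
        exact ⟨i, s, by simp [hs], hr⟩
      · simp at h
    · simp at h
  · rintro ⟨i, s, h, hr⟩
    obtain ⟨hi, h⟩ := List.getElem?_eq_some_iff.1 h
    exact ⟨p, ⟨i, hi⟩, by simp [h, hr]⟩

theorem mem_transitions {cs : List (Cell A)} {p q : Fin cs.length} {a : A} :
    (p, a, q) ∈ transitions cs ↔
      ∃ s, cs[q.val]? = some (s, .letter a) ∧ Rel cs p (src s q) := by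
  simp only [transitions, List.mem_flatMap, List.mem_finRange, true_and]
  constructor
  · rintro ⟨p', q', h⟩
    split at h
    · rename_i s b hs
      split_ifs at h with hr
      · have := List.mem_singleton.1 h
        simp only [Prod.mk.injEq] at this
        obtain ⟨rfl, rfl, rfl⟩ := this
        exact ⟨s, by simp [hs], hr⟩
      · simp at h
    · simp at h
  · rintro ⟨s, h, hr⟩
    obtain ⟨hi, h⟩ := List.getElem?_eq_some_iff.1 h
    exact ⟨p, q, by simp [h, hr]⟩

theorem mem_eval_nil {cs : List (Cell A)} {p : Fin (automaton cs).numStates} :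
    p ∈ (automaton cs).toNFA.eval [] ↔ ∃ s, cs[p.val]? = some (s, .sep) := by
  rw [NFA.eval_nil]
  exact mem_startStates

theorem mem_eval_concat {cs : List (Cell A)} {q : Fin (automaton cs).numStates} {u : List A}
    {a : A} : q ∈ (automaton cs).toNFA.eval (u ++ [a]) ↔ ∃ p ∈ (automaton cs).toNFA.eval u,
      ∃ s, cs[q.val]? = some (s, .letter a) ∧ Rel cs p.val (src s q.val) := by
  rw [NFA.eval_append_singleton, NFA.mem_stepSet]
  exact exists_congr fun p => and_congr_right fun _ => mem_transitions

/-- The automaton describes the reachable configurations of the pushdown system. For the forward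
direction, the path is followed along the run: a push extends it by one letter, and a pop removes
the last letter, where `Rel.pop` replaces the part of the run above the new top. -/
theorem reachable_iff {cs : List (Cell A)} (hsep : ∃ (i : ℕ) (s : Bool), cs[i]? = some (s, .sep))
    (q : ℕ) (u : List A) :
    ReflTransGen (Move cs) (0, []) (q, u) ↔
      ∃ p ∈ (automaton cs).toNFA.eval u, Rel cs p.val q := by
  constructor
  · intro h
    generalize hc : (q, u) = c at h
    induction h generalizing q u with
    | refl =>
      obtain ⟨rfl, rfl⟩ := Prod.mk.inj hc
      obtain ⟨i, s, hi⟩ := hsep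
      obtain ⟨hi', -⟩ := List.getElem?_eq_some_iff.1 hi
      exact ⟨⟨i, hi'⟩, mem_eval_nil.2 ⟨s, hi⟩, .sep hi⟩
    | tail _ h ih =>
      cases h with
      | @letter i s a v hi =>
        obtain ⟨rfl, rfl⟩ := Prod.mk.inj hc
        obtain ⟨p, hp, hr⟩ := ih _ _ rfl
        obtain ⟨hi', -⟩ := List.getElem?_eq_some_iff.1 hi
        exact ⟨⟨i, hi'⟩, mem_eval_concat.2 ⟨p, hp, s, hi, hr⟩, .letter hi⟩
      | @back i s v hi =>
        obtain ⟨rfl, rfl⟩ := Prod.mk.inj hc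
        obtain ⟨p, hp, hr⟩ := ih _ _ rfl
        rcases List.eq_nil_or_concat v with rfl | ⟨v, a, rfl⟩
        · obtain ⟨s', hs'⟩ := mem_eval_nil.1 hp
          exact ⟨p, hp, .bottom hs' hi hr⟩
        · rw [List.concat_eq_append] at hp ⊢
          obtain ⟨p', hp', s', hs', hr'⟩ := mem_eval_concat.1 hp
          rw [List.dropLast_concat]
          exact ⟨p', hp', .pop hs' hi hr' hr⟩
      | @endTransient i s v hi =>
        obtain ⟨rfl, rfl⟩ := Prod.mk.inj hc
        obtain ⟨p, hp, hr⟩ := ih _ _ rfl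
        exact ⟨p, hp, .endTransient hi hr⟩
  · rintro ⟨p, hp, hr⟩
    induction u using List.reverseRecOn generalizing p q with
    | nil =>
      obtain ⟨s, hs⟩ := mem_eval_nil.1 hp
      exact hr.sound_sep hs
    | append_singleton u a ih =>
      obtain ⟨p', hp', s, hs, hr'⟩ := mem_eval_concat.1 hp
      exact ((ih _ p' hp' hr').tail (.letter u hs)).trans (hr.sound_letter hs _)

theorem automaton_accepts {cs : List (Cell A)}
    (hsep : ∃ (i : ℕ) (s : Bool), cs[i]? = some (s, .sep)) :
    (automaton cs).toNFA.accepts = {u | ∃ (i : ℕ) (s : Bool), cs[i]? = some (s, .endFinal) ∧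
      ReflTransGen (Move cs) (0, []) (src s i, u)} := by
  ext u
  change (∃ p ∈ (automaton cs).toNFA.accept, p ∈ (automaton cs).toNFA.eval u) ↔ _
  constructor
  · rintro ⟨p, hp, hu⟩
    obtain ⟨i, s, hi, hr⟩ := mem_acceptStates.1 hp
    exact ⟨i, s, hi, (reachable_iff hsep _ _).2 ⟨p, hu, hr⟩⟩
  · rintro ⟨i, s, hi, hr⟩
    obtain ⟨p, hu, hr⟩ := (reachable_iff hsep _ _).1 hr
    exact ⟨p, mem_acceptStates.2 ⟨i, s, hi, hr⟩, hu⟩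

/-! ### The cells of a keyboard -/

/-- The cells of a final key (`b = true`) or a transient key (`b = false`). -/
def keyCells (b : Bool) (t : Key A) : List (Cell A) :=
  annotate (b, true) (t.map InSymbol.op ++ [InSymbol.endKey])

theorem annotate_append (q : Bool × Bool) (l l' : List (InSymbol A)) :
    annotate q (l ++ l') = annotate q l ++ annotate (l.foldl nextState q) l' := by
  induction l generalizing q with
  | nil => rfl
  | cons x l ih => simp [annotate, ih]

theorem foldl_nextState_key (b s : Bool) (t : Key A) :
    (t.map InSymbol.op ++ [InSymbol.endKey]).foldl nextState (b, s) = (b, true) := by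
  induction t generalizing s with
  | nil => rfl
  | cons x t ih => exact ih false

theorem annotate_encodeKeys (b : Bool) (l : List (Key A)) :
    annotate (b, true) (encodeKeys l) = l.flatMap (keyCells b) ∧
      (encodeKeys l).foldl nextState (b, true) = (b, true) := by
  induction l with
  | nil => exact ⟨rfl, rfl⟩
  | cons t l ih =>
    have h : encodeKeys (t :: l) = (t.map InSymbol.op ++ [InSymbol.endKey]) ++ encodeKeys l := rfl
    rw [h, annotate_append, foldl_nextState_key, ih.1]
    refine ⟨rfl, List.foldl_append.trans ?_⟩
    rw [foldl_nextState_key, ih.2]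

/-- The cells of a listed keyboard. -/
def cellsOf (T F : List (Key A)) : List (Cell A) :=
  annotate (false, true) (encodeKeyboard T F)

theorem cellsOf_eq (T F : List (Key A)) :
    cellsOf T F = T.flatMap (keyCells false) ++ (true, .sep) :: F.flatMap (keyCells true) := by
  rw [cellsOf, encodeKeyboard, annotate_append, (annotate_encodeKeys false T).1,
    (annotate_encodeKeys false T).2]
  simp only [annotate, cellOf, nextState, (annotate_encodeKeys true F).1]

theorem annotate_key_getElem? (b s : Bool) (t : Key A) (j : ℕ) :
    (annotate (b, s) (t.map InSymbol.op ++ [InSymbol.endKey]))[j]? =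
      if j = t.length then some (s && j == 0, Act.ofEnd A b)
      else (t[j]?).map fun σ => (s && j == 0, σ.toAct) := by
  induction t generalizing s j with
  | nil =>
    cases j with
    | zero => simp [annotate, cellOf]
    | succ j => simp [annotate]
  | cons x t ih =>
    cases j with
    | zero => simp [annotate, cellOf]
    | succ j => simp [annotate, nextState, ih]

/-- The key `t` is written in the array `cs` from position `o` on. -/
def WrittenAt (cs : List (Cell A)) (b : Bool) (t : Key A) (o : ℕ) : Prop :=
  (∀ (j : ℕ) (σ : Op A), t[j]? = some σ → cs[o + j]? = some (j == 0, σ.toAct)) ∧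
    cs[o + t.length]? = some (t.length == 0, .ofEnd A b)

theorem writtenAt_of_eq_append {cs l l' : List (Cell A)} {b : Bool} {t : Key A}
    (h : cs = l ++ (keyCells b t ++ l')) : WrittenAt cs b t l.length := by
  have key : ∀ (j : ℕ) (c : Cell A), (keyCells b t)[j]? = some c → cs[l.length + j]? = some c := by
    intro j c hc
    rw [h, List.getElem?_append_right (by omega), List.getElem?_append_left]
    · simpa using hc
    · simpa using (List.getElem?_eq_some_iff.1 hc).1
  constructor
  · intro j σ hj
    apply key
    have : j < t.length := (List.getElem?_eq_some_iff.1 hj).1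
    simp [keyCells, annotate_key_getElem?, hj, this.ne]
  · apply key
    simp [keyCells, annotate_key_getElem?]

theorem writtenAt_of_mem {T F : List (Key A)} {b : Bool} {t : Key A} (h : t ∈ bif b then F else T) :
    ∃ o, WrittenAt (cellsOf T F) b t o := by
  cases b with
  | false =>
    obtain ⟨l, l', rfl⟩ := List.append_of_mem h
    exact ⟨_, writtenAt_of_eq_append (l := l.flatMap (keyCells false))
      (l' := l'.flatMap (keyCells false) ++ (true, .sep) :: F.flatMap (keyCells true))
      (by simp [cellsOf_eq])⟩
  | true =>
    obtain ⟨l, l', rfl⟩ := List.append_of_mem h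
    exact ⟨_, writtenAt_of_eq_append
      (l := T.flatMap (keyCells false) ++ (true, .sep) :: l.flatMap (keyCells true))
      (l' := l'.flatMap (keyCells true)) (by simp [cellsOf_eq])⟩

theorem exists_of_getElem?_flatMap {α β : Type} (g : α → List β) (l : List α) (i : ℕ) (c : β)
    (h : (l.flatMap g)[i]? = some c) :
    ∃ l₁ t l₂ j, l = l₁ ++ t :: l₂ ∧ i = (l₁.flatMap g).length + j ∧ (g t)[j]? = some c := by
  induction l generalizing i with
  | nil => simp at h
  | cons t l ih =>
    rw [List.flatMap_cons] at h
    by_cases hi : i < (g t).length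
    · rw [List.getElem?_append_left hi] at h
      exact ⟨[], t, l, i, rfl, by simp, h⟩
    · rw [List.getElem?_append_right (by omega)] at h
      obtain ⟨l₁, t', l₂, j, rfl, hj, h⟩ := ih _ h
      exact ⟨t :: l₁, t', l₂, j, rfl, by rw [List.flatMap_cons, List.length_append]; omega, h⟩

/-- Every cell other than a separator belongs to a key. -/
theorem exists_writtenAt {T F : List (Key A)} {i : ℕ} {c : Cell A}
    (h : (cellsOf T F)[i]? = some c) (hc : c.2 ≠ .sep) :
    ∃ b t o j, (t ∈ bif b then F else T) ∧ WrittenAt (cellsOf T F) b t o ∧ i = o + j ∧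
      j ≤ t.length := by
  have hlen : ∀ (b : Bool) (t : Key A) (j : ℕ), (keyCells b t)[j]? = some c → j ≤ t.length := by
    intro b t j hj
    rw [keyCells, annotate_key_getElem?] at hj
    split_ifs at hj with h
    · exact h.le
    · by_contra hlt
      rw [List.getElem?_eq_none (by omega)] at hj
      simp at hj
  have h' := h
  rw [cellsOf_eq] at h'
  by_cases hi : i < (T.flatMap (keyCells (A := A) false)).length
  · rw [List.getElem?_append_left hi] at h'
    obtain ⟨l₁, t, l₂, j, rfl, rfl, hj⟩ := exists_of_getElem?_flatMap _ _ _ _ h'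
    refine ⟨false, t, _, j, by simp, writtenAt_of_eq_append (l := l₁.flatMap (keyCells false))
      (l' := l₂.flatMap (keyCells false) ++ (true, .sep) :: F.flatMap (keyCells true))
      (by simp [cellsOf_eq]), rfl, hlen _ _ _ hj⟩
  · rw [List.getElem?_append_right (by omega)] at h'
    cases hk : i - (T.flatMap (keyCells (A := A) false)).length with
    | zero =>
      rw [hk] at h'
      simp at h'
      exact absurd (by rw [← h']) hc
    | succ k =>
      rw [hk, List.getElem?_cons_succ] at h'
      obtain ⟨l₁, t, l₂, j, rfl, rfl, hj⟩ := exists_of_getElem?_flatMap _ _ _ _ h'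
      refine ⟨true, t, _, j, by simp, writtenAt_of_eq_append
        (l := T.flatMap (keyCells false) ++ (true, .sep) :: l₁.flatMap (keyCells true))
        (l' := l₂.flatMap (keyCells true)) (by simp [cellsOf_eq]), ?_, hlen _ _ _ hj⟩
      rw [List.length_append, List.length_cons]
      omega

theorem WrittenAt.add_length_lt {cs : List (Cell A)} {b : Bool} {t : Key A} {o : ℕ}
    (h : WrittenAt cs b t o) : o + t.length < cs.length :=
  (List.getElem?_eq_some_iff.1 h.2).1

/-- A letter or a backspace is not the last cell. -/
theorem succ_lt_length_cellsOf {T F : List (Key A)} {i : ℕ} {c : Cell A}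
    (h : (cellsOf T F)[i]? = some c) (hc : c.2 = .back ∨ ∃ a, c.2 = .letter a) :
    i + 1 < (cellsOf T F).length := by
  obtain ⟨b, t, o, j, -, ht, rfl, hj⟩ := exists_writtenAt h
    (by rcases hc with hc | ⟨a, hc⟩ <;> simp [hc])
  have := ht.add_length_lt
  rcases hj.lt_or_eq with hj | rfl
  · omega
  · rw [ht.2, Option.some_inj] at h
    subst h
    cases b <;> simp [Act.ofEnd] at hc

/-! ### Runs of a keyboard and runs of its pushdown system -/

/-- The effect of a key on the word before the cursor. -/
def runKey (u : List A) (t : Key A) : List A := (t.map Op.toAct).foldl Act.run u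

theorem actKey_eq_runKey {t : Key A} (ht : Op.leftArrow ∉ t ∧ Op.rightArrow ∉ t) (u : List A) :
    (⟨u, []⟩ : Config A).actKey t = ⟨runKey u t, []⟩ := by
  induction t generalizing u with
  | nil => rfl
  | cons σ t ih =>
    simp only [List.mem_cons, not_or] at ht
    have h : (⟨u, []⟩ : Config A).act σ = ⟨σ.toAct.run u, []⟩ := by
      cases σ with
      | letter a => rfl
      | backspace => rfl
      | leftArrow => exact absurd rfl ht.1.1
      | rightArrow => exact absurd rfl ht.2.1
    have := ih ⟨ht.1.2, ht.2.2⟩ (σ.toAct.run u)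
    rw [← h] at this
    exact this

theorem runKey_take_succ {t : Key A} {j : ℕ} {σ : Op A} (h : t[j]? = some σ) (u : List A) :
    runKey u (t.take (j + 1)) = σ.toAct.run (runKey u (t.take j)) := by
  simp [runKey, List.take_add_one, h]

theorem actKeys_eq_foldl {τ : List (Key A)} (hτ : ∀ t ∈ τ, Op.leftArrow ∉ t ∧ Op.rightArrow ∉ t)
    (u : List A) : (⟨u, []⟩ : Config A).actKeys τ = ⟨τ.foldl runKey u, []⟩ := by
  induction τ generalizing u with
  | nil => rfl
  | cons t τ ih =>
    have h1 := actKey_eq_runKey (hτ t (by simp)) u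
    have h2 := ih (fun t ht => hτ t (by simp [ht])) (runKey u t)
    rw [← h1] at h2
    exact h2

theorem src_beq_zero (o j : ℕ) : src (j == 0) (o + j) = if j = 0 then 0 else o + j := by
  cases j <;> simp [src]

/-- A beginning of a key can be executed on every stack. -/
theorem WrittenAt.reach {cs : List (Cell A)} {b : Bool} {t : Key A} {o : ℕ}
    (h : WrittenAt cs b t o) (ht : Op.leftArrow ∉ t ∧ Op.rightArrow ∉ t) (u : List A) (j : ℕ)
    (hj : j ≤ t.length) :
    ReflTransGen (Move cs) (0, u) (src (j == 0) (o + j), runKey u (t.take j)) := by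
  induction j with
  | zero => exact .refl
  | succ j ih =>
    have hσ : t[j]? = some t[j] := List.getElem?_eq_getElem hj
    refine (ih (by omega)).tail ?_
    rw [runKey_take_succ hσ, src_beq_zero o (j + 1), if_neg (Nat.succ_ne_zero _)]
    have hc := h.1 j _ hσ
    have hmem : t[j] ∈ t := List.getElem_mem hj
    cases hop : t[j] with
    | letter a => rw [hop] at hc; exact .letter _ hc
    | backspace => rw [hop] at hc; exact .back _ hc
    | leftArrow => exact absurd (hop ▸ hmem) ht.1
    | rightArrow => exact absurd (hop ▸ hmem) ht.2

theorem WrittenAt.eq_of_getElem? {cs : List (Cell A)} {b : Bool} {t : Key A} {o j : ℕ}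
    (h : WrittenAt cs b t o) (hj : j ≤ t.length) {c : Cell A} (hc : cs[o + j]? = some c) :
    (∃ σ, t[j]? = some σ ∧ c = (j == 0, σ.toAct)) ∨ (j = t.length ∧ c = (j == 0, .ofEnd A b)) := by
  rcases hj.lt_or_eq with hj | rfl
  · have hσ : t[j]? = some t[j] := List.getElem?_eq_getElem hj
    exact Or.inl ⟨_, hσ, Option.some_inj.1 (hc.symm.trans (h.1 j _ hσ))⟩
  · exact Or.inr ⟨rfl, Option.some_inj.1 (hc.symm.trans h.2)⟩

/-- The word `u` is obtained in the state `q` by applying some transient keys and then a beginning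
of a key, which ends at the position `q` unless it is empty. -/
def Traced (T F : List (Key A)) (q : ℕ) (u : List A) : Prop :=
  ∃ τ : List (Key A), (∀ t ∈ τ, t ∈ T) ∧ ((q = 0 ∧ u = τ.foldl runKey []) ∨
    ∃ b t o j, (t ∈ bif b then F else T) ∧ WrittenAt (cellsOf T F) b t o ∧ j ≤ t.length ∧
      0 < j ∧ q = o + j ∧ u = runKey (τ.foldl runKey []) (t.take j))

/-- The cell executed next belongs to the key whose beginning has been applied. -/
theorem Traced.exists_key {T F : List (Key A)} {i : ℕ} {u : List A} {s : Bool} {x : Act A}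
    (h : Traced T F (src s i) u) (hi : (cellsOf T F)[i]? = some (s, x)) (hx : x ≠ .sep) :
    ∃ τ : List (Key A), (∀ t ∈ τ, t ∈ T) ∧ ∃ b t o j, (t ∈ bif b then F else T) ∧
      WrittenAt (cellsOf T F) b t o ∧ j ≤ t.length ∧ i = o + j ∧
      u = runKey (τ.foldl runKey []) (t.take j) := by
  obtain ⟨τ, hτ, ⟨h0, rfl⟩ | ⟨b, t, o, j, ht, hw, hj, hj0, hq, rfl⟩⟩ := h
  · obtain ⟨b, t, o, j, ht, hw, rfl, hj⟩ := exists_writtenAt hi hx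
    refine ⟨τ, hτ, b, t, o, j, ht, hw, hj, rfl, ?_⟩
    have hs : s = (j == 0) := by
      rcases hw.eq_of_getElem? hj hi with ⟨σ, -, h⟩ | ⟨-, h⟩ <;> exact (Prod.mk.inj h).1
    rw [hs, src_beq_zero] at h0
    have : j = 0 := by
      split_ifs at h0 with h <;> omega
    subst this
    rfl
  · refine ⟨τ, hτ, b, t, o, j, ht, hw, hj, ?_, rfl⟩
    cases s with
    | false => exact hq
    | true => simp [src] at hq; omega

/-- Every run of the pushdown system follows the keys of the keyboard. -/
theorem traced_of_reachable {T F : List (Key A)} {q : ℕ} {u : List A}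
    (h : ReflTransGen (Move (cellsOf T F)) (0, []) (q, u)) : Traced T F q u := by
  generalize hc : (q, u) = c at h
  induction h generalizing q u with
  | refl =>
    obtain ⟨rfl, rfl⟩ := Prod.mk.inj hc
    exact ⟨[], by simp, Or.inl ⟨rfl, rfl⟩⟩
  | tail _ h ih =>
    -- a letter or a backspace extends the beginning of the key
    have main : ∀ (i : ℕ) (s : Bool) (v : List A) (x : Act A), Traced T F (src s i) v →
        (cellsOf T F)[i]? = some (s, x) → (x = .back ∨ ∃ a, x = .letter a) →
        Traced T F (i + 1) (x.run v) := by
      intro i s v x hv hi hx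
      obtain ⟨τ, hτ, b, t, o, j, ht, hw, hj, rfl, rfl⟩ := hv.exists_key hi
        (by rcases hx with rfl | ⟨a, rfl⟩ <;> simp)
      rcases hw.eq_of_getElem? hj hi with ⟨σ, hσ, h⟩ | ⟨-, h⟩
      · refine ⟨τ, hτ, Or.inr ⟨b, t, o, j + 1, ht, hw,
          (List.getElem?_eq_some_iff.1 hσ).1, by omega, by omega, ?_⟩⟩
        rw [runKey_take_succ hσ, (Prod.mk.inj h).2]
      · have := (Prod.mk.inj h).2
        subst this
        cases b <;> simp [Act.ofEnd] at hx
    cases h with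
    | @letter i s a v hi =>
      obtain ⟨rfl, rfl⟩ := Prod.mk.inj hc
      exact main i s v _ (ih rfl) hi (Or.inr ⟨a, rfl⟩)
    | @back i s v hi =>
      obtain ⟨rfl, rfl⟩ := Prod.mk.inj hc
      exact main i s v _ (ih rfl) hi (Or.inl rfl)
    | @endTransient i s v hi =>
      obtain ⟨rfl, rfl⟩ := Prod.mk.inj hc
      obtain ⟨τ, hτ, b, t, o, j, ht, hw, hj, rfl, rfl⟩ := (ih rfl).exists_key hi (by simp)
      rcases hw.eq_of_getElem? hj hi with ⟨σ, hσ, h⟩ | ⟨rfl, h⟩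
      · have := (Prod.mk.inj h).2
        cases σ <;> simp [Op.toAct] at this
      · have := (Prod.mk.inj h).2
        cases b with
        | true => simp [Act.ofEnd] at this
        | false =>
          refine ⟨τ ++ [t], ?_, Or.inl ⟨rfl, by simp⟩⟩
          intro t' ht'
          rcases List.mem_append.1 ht' with h | h
          · exact hτ t' h
          · rw [List.mem_singleton.1 h]; exact ht

theorem reachable_of_transient {T F : List (Key A)}
    (hT : ∀ t ∈ T, Op.leftArrow ∉ t ∧ Op.rightArrow ∉ t) {τ : List (Key A)} (hτ : ∀ t ∈ τ, t ∈ T)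
    (u : List A) : ReflTransGen (Move (cellsOf T F)) (0, u) (0, τ.foldl runKey u) := by
  induction τ generalizing u with
  | nil => exact .refl
  | cons t τ ih =>
    have ht := hτ t (by simp)
    obtain ⟨o, ho⟩ := writtenAt_of_mem (F := F) (b := false) ht
    have h := ho.reach (hT t ht) u t.length le_rfl
    rw [List.take_length] at h
    exact (h.tail (.endTransient _ ho.2)).trans (ih (fun t ht => hτ t (by simp [ht])) _)

theorem exists_sep (T F : List (Key A)) :
    ∃ (i : ℕ) (s : Bool), (cellsOf T F)[i]? = some (s, .sep) :=
  ⟨(T.flatMap (keyCells false)).length, true, by simp [cellsOf_eq]⟩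

/-- The automaton computed from the cells of a keyboard recognises the language of the keyboard. -/
theorem automaton_accepts_eq_language {K : Keyboard A} (hK : K.IsBEK) {T F : List (Key A)}
    (h : K.IsListing T F) : (automaton (cellsOf T F)).toNFA.accepts = K.language := by
  have hT : ∀ t, t ∈ T ↔ t ∈ K.transientKeys := fun t => by
    rw [← Finset.mem_val, ← h.1, Multiset.mem_coe]
  have hF : ∀ t, t ∈ F ↔ t ∈ K.finalKeys := fun t => by
    rw [← Finset.mem_val, ← h.2, Multiset.mem_coe]
  have run_eq : ∀ (τ : List (Key A)) (f : Key A), (∀ t ∈ τ, t ∈ K.transientKeys) →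
      f ∈ K.finalKeys → (Config.empty A).actKeys (τ ++ [f]) =
        ⟨runKey (τ.foldl runKey []) f, []⟩ := by
    intro τ f hτ hf
    have := actKeys_eq_foldl (τ := τ ++ [f]) (fun t ht => by
      rcases List.mem_append.1 ht with h | h
      · exact hK t (Or.inl (hτ t h))
      · exact hK t (Or.inr (by rwa [List.mem_singleton.1 h]))) []
    rwa [List.foldl_append] at this
  rw [automaton_accepts (exists_sep T F)]
  ext w
  constructor
  · rintro ⟨i, s, hi, hr⟩
    obtain ⟨τ, hτ, b, t, o, j, ht, hw, hj, rfl, rfl⟩ :=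
      (traced_of_reachable hr).exists_key hi (by simp)
    rcases hw.eq_of_getElem? hj hi with ⟨σ, hσ, h⟩ | ⟨rfl, h⟩
    · have := (Prod.mk.inj h).2
      cases σ <;> simp [Op.toAct] at this
    · have := (Prod.mk.inj h).2
      cases b with
      | false => simp [Act.ofEnd] at this
      | true =>
        have hτ' : ∀ t ∈ τ, t ∈ K.transientKeys := fun t ht => (hT t).1 (hτ t ht)
        refine ⟨τ, t, _, [], hτ', (hF t).1 ht, run_eq τ t hτ' ((hF t).1 ht), ?_⟩
        simp
  · rintro ⟨τ, f, u, v, hτ, hf, huv, rfl⟩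
    rw [run_eq τ f hτ hf, Config.mk.injEq] at huv
    obtain ⟨rfl, rfl⟩ := huv
    obtain ⟨o, ho⟩ := writtenAt_of_mem (T := T) (b := true) ((hF f).2 hf)
    refine ⟨_, _, ho.2, ?_⟩
    rw [List.append_nil]
    have h1 := reachable_of_transient (F := F) (fun t ht => hK t (Or.inl ((hT t).1 ht)))
      (fun t ht => (hT t).2 (hτ t ht)) []
    have h2 := ho.reach (hK f (Or.inr hf)) (τ.foldl runKey []) f.length le_rfl
    rw [List.take_length] at h2
    exact h1.trans h2

/-! ### Saturation of the table -/

namespace Cmd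

variable {C O : Type}

/-- The variable that holds the number of the state in which the cell at position `v` is executed.
The variable `5` is never assigned, so that its value is `0`. -/
def srcVar (s : Bool) (v : Fin 6) : Fin 6 := bif s then 5 else v

/-- The rules of `Rel` without premises, for the cell at position `2`. -/
def baseRule : Cell A → Cmd (Cell A) O
  | (_, .letter _) => mark 2 2 true
  | (_, .sep) => mark 2 5 false
  | _ => skip

/-- The rule `Rel.bottom`, for the cell at position `2` and a backspace at position `3`. -/
def bottomRule (s : Bool) : Cell A → Cmd (Cell A) O
  | (_, .sep) => test 2 (srcVar s 3) (mark 2 3 true)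
  | _ => skip

/-- The rule `Rel.pop`, for the cell at position `4` and a backspace at position `3`. -/
def popRule (s : Bool) : Cell A → Cmd (Cell A) O
  | (s', .letter _) => test 2 (srcVar s' 4) (test 4 (srcVar s 3) (mark 2 3 true))
  | _ => skip

/-- The rules of `Rel` with a premise that refers to the cell at position `3`. -/
def cellRule : Cell A → Cmd (Cell A) O
  | (s, .endTransient) => test 2 (srcVar s 3) (mark 2 5 false)
  | (s, .back) => seq (read 2 (bottomRule s)) (loop 4 (read 4 (popRule s)))
  | _ => skip

/-- One round of the saturation: every rule of `Rel` is applied once to all its instances. -/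
def round : Cmd (Cell A) O := loop 2 (seq (read 2 baseRule) (loop 3 (read 3 cellRule)))

/-- The computation of the table of `Rel`: as many rounds as the table has entries. -/
def saturate : Cmd (Cell A) O :=
  seq (loop 0 (loop 1 grow)) (loop 0 (loop 1 round))

/-- The output of the transition from the position `0` to the cell at position `1`. -/
def transRule : Cell A → Cmd (Cell A) (OutSymbol A)
  | (s, .letter a) => test 0 (srcVar s 1) (seq (emit .endItem) (seq (emitVar 1 .tick)
      (seq (emit (.letter a)) (emitVar 0 .tick))))
  | _ => skip

/-- The output of the position `0` as an accepting state. -/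
def acceptRule : Cell A → Cmd (Cell A) (OutSymbol A)
  | (s, .endFinal) => test 0 (srcVar s 1) (seq (emit .endItem) (emitVar 0 .tick))
  | _ => skip

/-- The output of the position `0` as an initial state. -/
def startRule : Cell A → Cmd (Cell A) (OutSymbol A)
  | (_, .sep) => seq (emit .endItem) (emitVar 0 .tick)
  | _ => skip

/-- The computation of the encoded automaton from the table of `Rel`, in reverse order. -/
def emitAutomaton : Cmd (Cell A) (OutSymbol A) :=
  seq (loop 0 (loop 1 (read 1 transRule))) <|
  seq (emit .endBlock) <|
  seq (loop 0 (loop 1 (read 1 acceptRule))) <|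
  seq (emit .endBlock) <|
  seq (loop 0 (read 0 startRule)) <|
  seq (emit .endBlock) (loop 0 (emit .tick))

theorem scoped_main : (seq saturate emitAutomaton : Cmd (Cell A) (OutSymbol A)).Scoped 0 := by
  have h1 : (round : Cmd (Cell A) (OutSymbol A)).Scoped 2 := by
    refine ⟨rfl, fun c => ?_, rfl, fun c => ?_⟩
    · rcases c with ⟨s, _ | _⟩ <;> trivial
    · rcases c with ⟨s, _ | _⟩
      case back => exact ⟨fun c => by rcases c with ⟨s, _ | _⟩ <;> trivial, rfl,
        fun c => by rcases c with ⟨s, _ | _⟩ <;> trivial⟩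
      all_goals trivial
  refine ⟨⟨⟨rfl, rfl, trivial⟩, rfl, rfl, h1⟩, ⟨rfl, rfl, fun c => ?_⟩, trivial,
    ⟨rfl, rfl, fun c => ?_⟩, trivial, ⟨rfl, fun c => ?_⟩, trivial, rfl, trivial⟩ <;>
  rcases c with ⟨s, _ | _⟩ <;> simp [transRule, acceptRule, startRule, Scoped]

/-- Programs that only mark entries of the table. -/
def Quiet : Cmd C O → Prop
  | seq P Q => P.Quiet ∧ Q.Quiet
  | loop _ P => P.Quiet
  | read _ f => ∀ c, (f c).Quiet
  | test _ _ P => P.Quiet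
  | emit _ => False
  | emitVar _ _ => False
  | grow => False
  | _ => True

theorem quiet_baseRule (c : Cell A) : (baseRule c : Cmd (Cell A) O).Quiet := by
  rcases c with ⟨s, _ | _⟩ <;> trivial

theorem quiet_bottomRule (s : Bool) (c : Cell A) : (bottomRule s c : Cmd (Cell A) O).Quiet := by
  rcases c with ⟨s, _ | _⟩ <;> trivial

theorem quiet_popRule (s : Bool) (c : Cell A) : (popRule s c : Cmd (Cell A) O).Quiet := by
  rcases c with ⟨s, _ | _⟩ <;> trivial

theorem quiet_cellRule (c : Cell A) : (cellRule c : Cmd (Cell A) O).Quiet := by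
  rcases c with ⟨s, _ | _⟩
  case back => exact ⟨quiet_bottomRule s, quiet_popRule s⟩
  all_goals trivial

theorem quiet_round : (round : Cmd (Cell A) O).Quiet := ⟨quiet_baseRule, quiet_cellRule⟩

/-- All entries that are marked in the first table are marked in the second one. -/
abbrev Sub (t t' : List Bool) : Prop := List.Forall₂ (fun a b => a ≤ b) t t'

theorem Sub.refl (t : List Bool) : Sub t t := List.forall₂_same.2 fun _ _ => le_rfl

theorem Sub.trans {t₁ t₂ t₃ : List Bool} (h : Sub t₁ t₂) (h' : Sub t₂ t₃) : Sub t₁ t₃ := by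
  induction h generalizing t₃ with
  | nil => exact h'
  | cons hab _ ih =>
    cases h' with
    | cons hbc h' => exact .cons (hab.trans hbc) (ih h')

theorem sub_set (t : List Bool) (k : ℕ) : Sub t (t.set k true) := by
  induction t generalizing k with
  | nil => exact .nil
  | cons a t ih =>
    cases k with
    | zero => exact .cons (Bool.le_true a) (Sub.refl t)
    | succ k => exact .cons le_rfl (ih k)

theorem Sub.getElem? {t t' : List Bool} (h : Sub t t') {k : ℕ} (hk : t[k]? = some true) :
    t'[k]? = some true := by
  induction h generalizing k with
  | nil => simp at hk
  | @cons a b _ _ hab _ ih =>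
    cases k with
    | zero =>
      simp at hk ⊢
      subst hk
      exact hab rfl
    | succ k => exact ih hk

theorem Sub.count_le {t t' : List Bool} (h : Sub t t') :
    t.count true ≤ t'.count true ∧ (t.count true = t'.count true → t = t') := by
  induction h with
  | nil => simp
  | @cons a b l l' hab _ ih =>
    obtain ⟨h1, h2⟩ := ih
    cases a <;> cases b
    · simpa using ⟨h1, h2⟩
    · simp; constructor <;> omega
    · exact absurd hab (by decide)
    · simpa using ⟨h1, h2⟩

theorem Sub.antisymm {t t' : List Bool} (h : Sub t t') (h' : Sub t' t) : t = t' :=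
  h.count_le.2 (le_antisymm h.count_le.1 h'.count_le.1)

variable {cs : List C} {env : Fin 6 → ℕ} {st : List Bool × List O}

theorem Quiet.sub {P : Cmd C O} (hP : P.Quiet) (env : Fin 6 → ℕ) (st : List Bool × List O) :
    Sub st.1 (P.eval cs env st).1 ∧ (P.eval cs env st).2 = st.2 := by
  induction P generalizing env st with
  | skip => exact ⟨Sub.refl _, rfl⟩
  | seq P Q ihP ihQ =>
    have h1 := ihP hP.1 env st
    have h2 := ihQ hP.2 env (P.eval cs env st)
    exact ⟨h1.1.trans h2.1, h2.2.trans h1.2⟩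
  | loop v P ih =>
    rw [eval]
    generalize List.range cs.length = l
    induction l with
    | nil => exact ⟨Sub.refl _, rfl⟩
    | cons i l ihl =>
      have h := ih hP (update env v i)
        (l.foldr (fun i st => P.eval cs (update env v i) st) st)
      exact ⟨ihl.1.trans h.1, h.2.trans ihl.2⟩
  | read v f ih =>
    rw [eval]
    split
    · exact ⟨Sub.refl _, rfl⟩
    · exact ih _ (hP _) _ _
  | test v w P ih =>
    rw [eval]
    split
    · exact ih hP _ _
    · exact ⟨Sub.refl _, rfl⟩
  | mark v w b => exact ⟨sub_set _ _, rfl⟩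
  | emit => exact hP.elim
  | emitVar => exact hP.elim
  | grow => exact hP.elim

/-- Marks are never removed, so that a sequence without effect has no effect in between either. -/
theorem Quiet.seq_fixed {P Q : Cmd C O} (hP : P.Quiet) (hQ : Q.Quiet)
    (h : (seq P Q).eval cs env st = st) : P.eval cs env st = st ∧ Q.eval cs env st = st := by
  have h1 := hP.sub (cs := cs) env st
  have h2 := hQ.sub (cs := cs) env (P.eval cs env st)
  change Q.eval cs env (P.eval cs env st) = st at h
  rw [h] at h2
  have : P.eval cs env st = st := Prod.ext (h2.1.antisymm h1.1) h1.2
  exact ⟨this, by rwa [this] at h⟩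

/-- If a loop has no effect, then its body has no effect for any value of the variable. -/
theorem Quiet.loop_fixed {P : Cmd C O} {v : Fin 6} (hP : P.Quiet)
    (h : (loop v P).eval cs env st = st) {i : ℕ} (hi : i < cs.length) :
    P.eval cs (update env v i) st = st := by
  have key : ∀ l : List ℕ, Sub st.1 (l.foldr (fun i st => P.eval cs (update env v i) st) st).1 ∧
      (l.foldr (fun i st => P.eval cs (update env v i) st) st).2 = st.2 := by
    intro l
    induction l with
    | nil => exact ⟨Sub.refl _, rfl⟩
    | cons i l ih =>
      have h := hP.sub (cs := cs) (update env v i)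
        (l.foldr (fun i st => P.eval cs (update env v i) st) st)
      exact ⟨ih.1.trans h.1, h.2.trans ih.2⟩
  rw [eval] at h
  have hi' := List.mem_range.2 hi
  generalize List.range cs.length = l at h hi'
  induction l with
  | nil => simp at hi'
  | cons j l ih =>
    have h1 := hP.sub (cs := cs) (update env v j)
      (l.foldr (fun i st => P.eval cs (update env v i) st) st)
    rw [List.foldr_cons] at h
    rw [h] at h1
    have e : l.foldr (fun i st => P.eval cs (update env v i) st) st = st :=
      Prod.ext (h1.1.antisymm (key l).1) (key l).2
    rcases List.mem_cons.1 hi' with rfl | hi'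
    · rwa [e] at h
    · exact ih e hi'

theorem eval_read {v : Fin 6} {f : C → Cmd C O} {c : C} (h : cs[env v]? = some c) :
    (read v f).eval cs env st = (f c).eval cs env st := by
  simp [eval, h]

theorem eval_test {v w : Fin 6} {P : Cmd C O}
    (h : st.1[env v * cs.length + env w]? = some true) :
    (test v w P).eval cs env st = P.eval cs env st := by
  simp [eval, h]

theorem mark_fixed {v w : Fin 6} {b : Bool} (h : (mark v w b).eval cs env st = st)
    (hlt : env v * cs.length + env w + b.toNat < st.1.length) :
    st.1[env v * cs.length + env w + b.toNat]? = some true := by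
  have h1 : st.1.set (env v * cs.length + env w + b.toNat) true = st.1 := congrArg Prod.fst h
  rw [← h1]
  simp [hlt]

theorem loop_induction {p : List Bool × List O → Prop} {v : Fin 6} {P : Cmd C O}
    (h : ∀ i < cs.length, ∀ st, p st → p (P.eval cs (update env v i) st)) (hst : p st) :
    p ((loop v P).eval cs env st) := by
  rw [eval]
  have key : ∀ l : List ℕ, (∀ i ∈ l, i < cs.length) →
      p (l.foldr (fun i st => P.eval cs (update env v i) st) st) := by
    intro l
    induction l with
    | nil => exact fun _ => hst
    | cons i l ih =>
      exact fun hl => h i (hl i (by simp)) _ (ih fun j hj => hl j (by simp [hj]))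
  exact key _ fun i hi => List.mem_range.1 hi

theorem read_induction {p : List Bool × List O → Prop} {v : Fin 6} {f : C → Cmd C O}
    (hst : p st) (h : ∀ c, cs[env v]? = some c → p ((f c).eval cs env st)) :
    p ((read v f).eval cs env st) := by
  cases hc : cs[env v]? with
  | none => simpa [eval, hc] using hst
  | some c => rw [eval_read hc]; exact h c hc

theorem test_induction {p : List Bool × List O → Prop} {v w : Fin 6} {P : Cmd C O}
    (hst : p st) (h : st.1[env v * cs.length + env w]? = some true → p (P.eval cs env st)) :
    p ((test v w P).eval cs env st) := by
  by_cases hc : st.1[env v * cs.length + env w]? = some true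
  · rw [eval_test hc]; exact h hc
  · simpa [eval, hc] using hst

/-- A loop makes progress as long as its body does, unless it reaches a goal. -/
theorem loop_progress {p g : List Bool × List O → Prop} {v : Fin 6} {P : Cmd C O} {k : ℕ}
    (h : ∀ i < cs.length, ∀ st, p st → p (P.eval cs (update env v i) st) ∧
      (g st → g (P.eval cs (update env v i) st)) ∧ (g (P.eval cs (update env v i) st) ∨
        st.1.count true + k ≤ (P.eval cs (update env v i) st).1.count true)) (hst : p st) :
    p ((loop v P).eval cs env st) ∧ (g st → g ((loop v P).eval cs env st)) ∧
      (g ((loop v P).eval cs env st) ∨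
        st.1.count true + cs.length * k ≤ ((loop v P).eval cs env st).1.count true) := by
  rw [eval]
  have key : ∀ l : List ℕ, (∀ i ∈ l, i < cs.length) →
      let st' := l.foldr (fun i st => P.eval cs (update env v i) st) st
      p st' ∧ (g st → g st') ∧
        (g st' ∨ st.1.count true + l.length * k ≤ st'.1.count true) := by
    intro l
    induction l with
    | nil => exact fun _ => ⟨hst, id, Or.inr (by simp)⟩
    | cons i l ih =>
      intro hl
      obtain ⟨h1, h2, h3⟩ := ih fun j hj => hl j (by simp [hj])
      obtain ⟨h4, h5, h6⟩ := h i (hl i (by simp)) _ h1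
      refine ⟨h4, fun hg => h5 (h2 hg), ?_⟩
      rcases h3 with h3 | h3
      · exact Or.inl (h5 h3)
      · rcases h6 with h6 | h6
        · exact Or.inl h6
        · refine Or.inr ?_
          rw [List.length_cons, Nat.succ_mul]
          simp only [List.foldr_cons]
          omega
  have := key (List.range cs.length) fun i hi => List.mem_range.1 hi
  rwa [List.length_range] at this

/-- All marked entries of the table are related, and the table has the right size. -/
def Sound (cs : List (Cell A)) (st : List Bool × List O) : Prop :=
  st.1.length = cs.length * cs.length ∧ ∀ i < cs.length, ∀ j < cs.length,
    st.1[i * cs.length + j]? = some true → Rel cs i j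

/-- All related entries of the table are marked. -/
def Complete (cs : List (Cell A)) (st : List Bool × List O) : Prop :=
  ∀ i < cs.length, ∀ j < cs.length, Rel cs i j → st.1[i * cs.length + j]? = some true

/-- Letters and backspaces are followed by another cell. Otherwise the entry after the end of a row
of the table would be marked, which is the first entry of the next row. -/
def Padded (cs : List (Cell A)) : Prop :=
  ∀ (i : ℕ) (c : Cell A), cs[i]? = some c → (c.2 = .back ∨ ∃ a, c.2 = .letter a) →
    i + 1 < cs.length

theorem index_lt {n i j : ℕ} (hi : i < n) (hj : j < n) : i * n + j < n * n := by
  nlinarith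

theorem index_inj {n i j i' j' : ℕ} (hj : j < n) (hj' : j' < n)
    (h : i * n + j = i' * n + j') : i = i' ∧ j = j' := by
  have hn : 0 < n := by omega
  have h1 : (i * n + j) / n = i := by
    rw [mul_comm, Nat.mul_add_div hn, Nat.div_eq_of_lt hj, add_zero]
  have h2 : (i' * n + j') / n = i' := by
    rw [mul_comm, Nat.mul_add_div hn, Nat.div_eq_of_lt hj', add_zero]
  have : i = i' := by rw [← h1, ← h2, h]
  subst this
  exact ⟨rfl, by omega⟩

theorem Sound.mark {cs : List (Cell A)} {env : Fin 6 → ℕ} {st : List Bool × List O}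
    (h : Sound cs st) {v w : Fin 6} {b : Bool} (hw : env w + b.toNat < cs.length)
    (hr : Rel cs (env v) (env w + b.toNat)) : Sound cs ((mark v w b).eval cs env st) := by
  refine ⟨by simpa [eval] using h.1, fun i hi j hj hij => ?_⟩
  by_cases he : env v * cs.length + env w + b.toNat = i * cs.length + j
  · rw [add_assoc] at he
    obtain ⟨h1, h2⟩ := index_inj hw hj he
    rw [← h1, ← h2]
    exact hr
  · rw [eval, List.getElem?_set_ne he] at hij
    exact h.2 i hi j hj hij

theorem env_srcVar {env : Fin 6 → ℕ} (h5 : env 5 = 0) (s : Bool) (v : Fin 6) :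
    env (srcVar s v) = src s (env v) := by
  cases s <;> simp [srcVar, src, h5]

theorem src_lt {s : Bool} {i n : ℕ} (h : i < n) : src s i < n := by
  cases s <;> simp [src] <;> omega

theorem sound_round {cs : List (Cell A)} (hcs : Padded cs) {env : Fin 6 → ℕ} (h5 : env 5 = 0)
    {st : List Bool × List O} (h : Sound cs st) : Sound cs (round.eval cs env st) := by
  refine loop_induction (fun p hp st h => ?_) h
  set e₂ := update env 2 p with he₂
  have e22 : e₂ 2 = p := by simp [he₂]
  have e25 : e₂ 5 = 0 := by simp [he₂, h5]
  refine loop_induction (fun r hr st h => ?_) (read_induction h fun c hc => ?_)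
  · set e₃ := update e₂ 3 r with he₃
    have e32 : e₃ 2 = p := by simp [he₃, e22]
    have e33 : e₃ 3 = r := by simp [he₃]
    have e35 : e₃ 5 = 0 := by simp [he₃, e25]
    refine read_induction h fun c hc => ?_
    obtain ⟨s, x⟩ := c
    rw [e33] at hc
    have read_sep : ∀ (st : List Bool × List O), Sound cs st → x = .back →
        Sound cs ((read 2 (bottomRule s) : Cmd (Cell A) O).eval cs e₃ st) := by
      rintro st h rfl
      refine read_induction h fun c' hc' => ?_
      obtain ⟨s', x'⟩ := c'
      rw [e32] at hc'
      cases x' with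
      | sep =>
        refine test_induction h fun ht => ?_
        rw [e32, env_srcVar e35, e33] at ht
        refine h.mark (by rw [e33]; exact hcs _ _ hc (Or.inl rfl)) ?_
        rw [e32, e33]
        exact .bottom hc' hc (h.2 _ hp _ (src_lt hr) ht)
      | _ => exact h
    cases x with
    | endTransient =>
      refine test_induction h fun ht => ?_
      rw [e32, env_srcVar e35, e33] at ht
      refine h.mark (by rw [e35]; simp; omega) ?_
      rw [e32, e35]
      exact .endTransient hc (h.2 _ hp _ (src_lt hr) ht)
    | back =>
      refine loop_induction (fun q hq st h => ?_) (read_sep st h rfl)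
      set e₄ := update e₃ 4 q with he₄
      have e42 : e₄ 2 = p := by simp [he₄, e32]
      have e43 : e₄ 3 = r := by simp [he₄, e33]
      have e44 : e₄ 4 = q := by simp [he₄]
      have e45 : e₄ 5 = 0 := by simp [he₄, e35]
      refine read_induction h fun c' hc' => ?_
      obtain ⟨s', x'⟩ := c'
      rw [e44] at hc'
      cases x' with
      | letter a =>
        refine test_induction h fun ht => test_induction h fun ht' => ?_
        rw [e42, env_srcVar e45, e44] at ht
        rw [e44, env_srcVar e45, e43] at ht'
        refine h.mark (by rw [e43]; exact hcs _ _ hc (Or.inl rfl)) ?_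
        rw [e42, e43]
        exact .pop hc' hc (h.2 _ hp _ (src_lt hq) ht) (h.2 _ hq _ (src_lt hr) ht')
      | _ => exact h
    | _ => exact h
  · obtain ⟨s, x⟩ := c
    rw [e22] at hc
    cases x with
    | letter a =>
      refine h.mark (by rw [e22]; exact hcs _ _ hc (Or.inr ⟨a, rfl⟩)) ?_
      rw [e22]
      exact .letter hc
    | sep =>
      refine h.mark (by rw [e25]; simp; omega) ?_
      rw [e22, e25]
      exact .sep hc
    | _ => exact h

/-- If a round has no effect, then the table is closed under the rules of `Rel`. -/
theorem complete_of_fixed {cs : List (Cell A)} (hcs : Padded cs) {env : Fin 6 → ℕ}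
    (h5 : env 5 = 0) {st : List Bool × List O} (h : Sound cs st)
    (hfix : round.eval cs env st = st) : Complete cs st := by
  have hlt : ∀ {i : ℕ} {c : Cell A}, cs[i]? = some c → i < cs.length := fun h =>
    (List.getElem?_eq_some_iff.1 h).1
  -- the effect of the rules on the row `p`
  have row : ∀ p < cs.length, (read 2 baseRule).eval cs (update env 2 p) st = st ∧
      (loop 3 (read 3 cellRule)).eval cs (update env 2 p) st = st := fun p hp =>
    Quiet.seq_fixed (P := read 2 baseRule) quiet_baseRule (Q := loop 3 (read 3 cellRule))
      quiet_cellRule (Quiet.loop_fixed (v := 2)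
        (P := seq (read 2 baseRule) (loop 3 (read 3 cellRule))) quiet_round hfix hp)
  have base : ∀ p < cs.length, ∀ c, cs[p]? = some c →
      (baseRule c).eval cs (update env 2 p) st = st := fun p hp c hc =>
    (eval_read (by simpa using hc)).symm.trans (row p hp).1
  have cell : ∀ p < cs.length, ∀ r < cs.length, ∀ c, cs[r]? = some c →
      (cellRule c).eval cs (update (update env 2 p) 3 r) st = st := fun p hp r hr c hc =>
    (eval_read (by simpa using hc)).symm.trans
      (Quiet.loop_fixed (P := read 3 cellRule) quiet_cellRule (row p hp).2 hr)
  have col : ∀ {p q : ℕ}, Rel cs p q → q < cs.length := by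
    intro p q h
    cases h with
    | letter h => exact hcs _ _ h (Or.inr ⟨_, rfl⟩)
    | sep h => have := hlt h; omega
    | bottom _ h => exact hcs _ _ h (Or.inl rfl)
    | endTransient h => have := hlt h; omega
    | pop _ h => exact hcs _ _ h (Or.inl rfl)
  have index : ∀ {i j : ℕ}, i < cs.length → j < cs.length → i * cs.length + j < st.1.length :=
    fun hi hj => h.1 ▸ index_lt hi hj
  intro i hi j hj hij
  induction hij with
  | @letter p s a hc =>
    have h2 := mark_fixed (v := 2) (w := 2) (b := true) (base p hi _ hc)
    simp only [update_self, Bool.toNat_true] at h2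
    exact h2 (index hi hj)
  | @sep p s hc =>
    have h2 := mark_fixed (v := 2) (w := 5) (b := false) (base p hi _ hc)
    simp only [update_self, Bool.toNat_false, ne_eq, Fin.reduceEq, not_false_eq_true,
      update_of_ne, h5] at h2
    exact h2 (index hi hj)
  | @bottom p s r s' hc hc' hr ih =>
    have h1 := cell p hi r (hlt hc') _ hc'
    have h2 := (Quiet.seq_fixed (P := read 2 (bottomRule s')) (quiet_bottomRule s')
      (Q := loop 4 (read 4 (popRule s'))) (quiet_popRule s') h1).1
    rw [eval_read (c := (s, .sep)) (by simpa using hc), bottomRule, eval_test] at h2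
    · have h3 := mark_fixed h2
      simp at h3
      exact h3 (index hi hj)
    · have := ih hi (col hr)
      rw [env_srcVar (env := update (update env 2 p) 3 r) (by simp [h5])]
      simpa using this
  | @endTransient p r s hc hr ih =>
    have h2 := cell p hi r (hlt hc) _ hc
    rw [cellRule, eval_test] at h2
    · have h3 := mark_fixed h2
      simp [h5] at h3
      exact h3 (index hi hj)
    · have := ih hi (col hr)
      rw [env_srcVar (env := update (update env 2 p) 3 r) (by simp [h5])]
      simpa using this
  | @pop p q r s a s' hc hc' hr hr' ih ih' =>
    have h1 := cell p hi r (hlt hc') _ hc'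
    have h2 := (Quiet.seq_fixed (P := read 2 (bottomRule s')) (quiet_bottomRule s')
      (Q := loop 4 (read 4 (popRule s'))) (quiet_popRule s') h1).2
    have h2 := Quiet.loop_fixed (P := read 4 (popRule s')) (quiet_popRule s') h2 (hlt hc)
    rw [eval_read (c := (s, .letter a)) (by simpa using hc), popRule, eval_test, eval_test] at h2
    · have h3 := mark_fixed h2
      simp at h3
      exact h3 (index hi hj)
    · have := ih' (hlt hc) (col hr')
      rw [env_srcVar (env := update (update (update env 2 p) 3 r) 4 q) (by simp [h5])]
      simpa using this
    · have := ih hi (col hr)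
      rw [env_srcVar (env := update (update (update env 2 p) 3 r) 4 q) (by simp [h5])]
      simpa using this

theorem eval_grow {cs : List C} (st : List Bool × List O) :
    (loop 0 (loop 1 grow)).eval cs (fun _ => 0) st =
      (List.replicate (cs.length * cs.length) false ++ st.1, st.2) := by
  have h1 : ∀ (env : Fin 6 → ℕ) (st : List Bool × List O), (loop 1 grow).eval cs env st =
      (List.replicate cs.length false ++ st.1, st.2) := by
    intro env st
    rw [eval]
    have : ∀ n, (List.range n).foldr (fun i st => (grow : Cmd C O).eval cs (update env 1 i) st) st =
        (List.replicate n false ++ st.1, st.2) := by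
      intro n
      induction n generalizing st with
      | zero => rfl
      | succ n ih =>
        rw [List.range_succ, List.foldr_append]
        exact (ih (false :: st.1, st.2)).trans (by simp [List.replicate_succ'])
    exact this _
  rw [eval]
  simp only [h1]
  have : ∀ n, (List.range n).foldr (fun _ (st : List Bool × List O) =>
      (List.replicate cs.length false ++ st.1, st.2)) st =
        (List.replicate (n * cs.length) false ++ st.1, st.2) := by
    intro n
    induction n generalizing st with
    | zero => simp
    | succ n ih =>
      rw [List.range_succ, List.foldr_append]
      exact (ih _).trans (by
        simp only [List.foldr_cons, List.foldr_nil, ← List.append_assoc, ← List.replicate_add,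
          Nat.succ_mul])
  exact this _

/-- Every round that does not complete the table adds a mark, so that after `n²` rounds on a table
with `n²` entries the table is complete. -/
theorem saturate_spec {cs : List (Cell A)} (hcs : Padded cs) :
    let st : List Bool × List O := saturate.eval cs (fun _ => 0) ([], [])
    Sound cs st ∧ Complete cs st ∧ st.2 = [] := by
  set st₀ : List Bool × List O := (List.replicate (cs.length * cs.length) false, []) with hst₀
  have e : (saturate.eval cs (fun _ => 0) ([], []) : List Bool × List O) =
      (loop 0 (loop 1 round)).eval cs (fun _ => 0) st₀ := by
    rw [saturate, eval, eval_grow]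
    simp [hst₀]
  have hs₀ : Sound cs st₀ := by
    refine ⟨by simp [hst₀], fun i _ j _ h => ?_⟩
    simp [hst₀, List.getElem?_replicate] at h
  have h1 : ∀ i < cs.length, ∀ st : List Bool × List O, Sound cs st →
      Sound cs ((loop 1 round).eval cs (update (fun _ => 0) 0 i) st) ∧
      (Complete cs st → Complete cs ((loop 1 round).eval cs (update (fun _ => 0) 0 i) st)) ∧
      (Complete cs ((loop 1 round).eval cs (update (fun _ => 0) 0 i) st) ∨
        st.1.count true + cs.length * 1 ≤
          ((loop 1 round).eval cs (update (fun _ => 0) 0 i) st).1.count true) := by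
    intro i _ st hst
    refine loop_progress (fun j _ st hst => ?_) hst
    set env : Fin 6 → ℕ := update (update (fun _ => 0) 0 i) 1 j with henv
    have h5 : env 5 = 0 := by simp [henv]
    have hsub := (quiet_round (A := A) (O := O)).sub (cs := cs) env st
    refine ⟨sound_round hcs h5 hst, fun hg i hi j hj hij => hsub.1.getElem? (hg i hi j hj hij), ?_⟩
    by_cases hfix : round.eval cs env st = st
    · exact Or.inl (by rw [hfix]; exact complete_of_fixed hcs h5 hst hfix)
    · refine Or.inr (lt_of_le_of_ne hsub.1.count_le.1 fun hc => hfix ?_)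
      exact Prod.ext (hsub.1.count_le.2 hc).symm hsub.2
  obtain ⟨h2, -, h3⟩ := loop_progress (v := 0) (env := fun _ => 0) h1 hs₀
  intro st
  rw [← e] at h2 h3
  refine ⟨h2, h3.elim id fun h3 => ?_, ?_⟩
  · -- all entries of the table are marked
    intro i hi j hj _
    have hall : st.1.count true = st.1.length := by
      refine le_antisymm List.count_le_length ?_
      rw [h2.1]
      rw [mul_one] at h3
      exact (Nat.le_add_left _ _).trans h3
    have hlt : i * cs.length + j < st.1.length := h2.1 ▸ index_lt hi hj
    rw [List.getElem?_eq_getElem hlt, Option.some_inj]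
    exact (List.count_eq_length.1 hall _ (List.getElem_mem hlt)).symm
  · have h4 := (show (loop 0 (loop 1 round) : Cmd (Cell A) O).Quiet from quiet_round).sub
      (cs := cs) (fun _ => 0) st₀
    rw [← e] at h4
    exact h4.2

/-! ### The encoding of the automaton -/

theorem eval_loop_emit {cs : List C} {env : Fin 6 → ℕ} {st : List Bool × List O} {v : Fin 6}
    {P : Cmd C O} {g : ℕ → List O} (h : ∀ i < cs.length, ∀ o : List O,
      P.eval cs (update env v i) (st.1, o) = (st.1, g i ++ o)) :
    (loop v P).eval cs env st = (st.1, (List.range cs.length).flatMap g ++ st.2) := by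
  rw [eval]
  have key : ∀ l : List ℕ, (∀ i ∈ l, i < cs.length) →
      l.foldr (fun i st => P.eval cs (update env v i) st) st = (st.1, l.flatMap g ++ st.2) := by
    intro l
    induction l with
    | nil => exact fun _ => rfl
    | cons i l ih =>
      intro hl
      rw [List.foldr_cons, ih fun j hj => hl j (by simp [hj]), h i (hl i (by simp))]
      simp
  exact key _ fun i hi => List.mem_range.1 hi

variable (cs : List (Cell A))

/-- The contribution of the position `p` to the encoding of the initial states. -/
def startItem (p : ℕ) : List (OutSymbol A) := match cs[p]? with
  | some (_, .sep) => encodeUnary A p ++ [.endItem]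
  | _ => []

open Classical in
/-- The contribution of the positions `p` and `i` to the encoding of the accepting states. -/
noncomputable def acceptItem (p i : ℕ) : List (OutSymbol A) := match cs[i]? with
  | some (s, .endFinal) => if Rel cs p (src s i) then encodeUnary A p ++ [.endItem] else []
  | _ => []

open Classical in
/-- The contribution of the positions `p` and `q` to the encoding of the transitions. -/
noncomputable def transItem (p q : ℕ) : List (OutSymbol A) := match cs[q]? with
  | some (s, .letter a) => if Rel cs p (src s q) then
      encodeUnary A p ++ .letter a :: (encodeUnary A q ++ [.endItem]) else []
  | _ => []

theorem flatMap_finRange {β : Type} (n : ℕ) (g : ℕ → List β) :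
    (List.finRange n).flatMap (fun i => g i.val) = (List.range n).flatMap g := by
  rw [← List.map_coe_finRange_eq_range, List.flatMap_map]

theorem encode_automaton : (automaton cs).encode =
    encodeUnary A cs.length ++ OutSymbol.endBlock ::
    ((List.range cs.length).flatMap (startItem cs) ++ OutSymbol.endBlock ::
    ((List.range cs.length).flatMap (fun p => (List.range cs.length).flatMap (acceptItem cs p)) ++
      OutSymbol.endBlock ::
    (List.range cs.length).flatMap fun p => (List.range cs.length).flatMap (transItem cs p))) := by
  have h1 : (startStates cs).flatMap (fun q : Fin cs.length =>
      encodeUnary A q.val ++ [OutSymbol.endItem]) =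
      (List.range cs.length).flatMap (startItem cs) := by
    rw [← flatMap_finRange, startStates, List.flatMap_assoc]
    refine congrArg (fun g => List.flatMap g _) (funext fun p => ?_)
    rw [startItem, List.getElem?_eq_getElem p.2]
    rcases cs[p.val] with ⟨s, _ | _⟩ <;> simp
  have h2 : (acceptStates cs).flatMap (fun q : Fin cs.length =>
      encodeUnary A q.val ++ [OutSymbol.endItem]) =
      (List.range cs.length).flatMap fun p =>
        (List.range cs.length).flatMap (acceptItem cs p) := by
    rw [← flatMap_finRange, acceptStates, List.flatMap_assoc]
    refine congrArg (fun g => List.flatMap g _) (funext fun p => ?_)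
    rw [← flatMap_finRange, List.flatMap_assoc]
    refine congrArg (fun g => List.flatMap g _) (funext fun i => ?_)
    rw [acceptItem, List.getElem?_eq_getElem i.2]
    rcases cs[i.val] with ⟨s, _ | _⟩ <;> simp
    split_ifs <;> simp
  have h3 : (transitions cs).flatMap (fun e : Fin cs.length × A × Fin cs.length =>
      encodeUnary A e.1.val ++
      OutSymbol.letter e.2.1 :: (encodeUnary A e.2.2.val ++ [OutSymbol.endItem])) =
      (List.range cs.length).flatMap fun p =>
        (List.range cs.length).flatMap (transItem cs p) := by
    rw [← flatMap_finRange, transitions, List.flatMap_assoc]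
    refine congrArg (fun g => List.flatMap g _) (funext fun p => ?_)
    rw [← flatMap_finRange, List.flatMap_assoc]
    refine congrArg (fun g => List.flatMap g _) (funext fun q => ?_)
    rw [transItem, List.getElem?_eq_getElem q.2]
    rcases cs[q.val] with ⟨s, _ | _⟩ <;> simp
    split_ifs <;> simp
  rw [← h1, ← h2, ← h3, ListedNFA.encode]
  simp only [List.bind_eq_flatMap, List.flatMap_assoc, List.pure_def, List.flatMap_singleton]
  rfl

variable {cs}

theorem emitAutomaton_spec {t : List Bool}
    (ht : ∀ i < cs.length, ∀ j < cs.length, t[i * cs.length + j]? = some true ↔ Rel cs i j) :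
    emitAutomaton.eval cs (fun _ => 0) (t, []) = (t, (automaton cs).encode) := by
  classical
  have h1 : ∀ o : List (OutSymbol A), (loop 0 (loop 1 (read 1 transRule))).eval cs (fun _ => 0)
      (t, o) = (t, ((List.range cs.length).flatMap fun p =>
        (List.range cs.length).flatMap (transItem cs p)) ++ o) := fun o => by
    refine eval_loop_emit fun p hp o => eval_loop_emit fun q hq o => ?_
    rw [eval_read (c := cs[q]) (by simp [hq]), transItem, List.getElem?_eq_getElem hq]
    rcases cs[q] with ⟨s, _ | _⟩
    case letter a =>
      simp only [transRule, eval]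
      rw [env_srcVar (env := update (update (fun _ => 0) 0 p) 1 q) (by simp)]
      simp [ht p hp _ (src_lt hq)]
      split_ifs <;> simp [encodeUnary]
    all_goals rfl
  have h2 : ∀ o : List (OutSymbol A), (loop 0 (loop 1 (read 1 acceptRule))).eval cs (fun _ => 0)
      (t, o) = (t, ((List.range cs.length).flatMap fun p =>
        (List.range cs.length).flatMap (acceptItem cs p)) ++ o) := fun o => by
    refine eval_loop_emit fun p hp o => eval_loop_emit fun q hq o => ?_
    rw [eval_read (c := cs[q]) (by simp [hq]), acceptItem, List.getElem?_eq_getElem hq]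
    rcases cs[q] with ⟨s, _ | _⟩
    case endFinal =>
      simp only [acceptRule, eval]
      rw [env_srcVar (env := update (update (fun _ => 0) 0 p) 1 q) (by simp)]
      simp [ht p hp _ (src_lt hq)]
      split_ifs <;> simp [encodeUnary]
    all_goals rfl
  have h3 : ∀ o : List (OutSymbol A), (loop 0 (read 0 startRule)).eval cs (fun _ => 0)
      (t, o) = (t, (List.range cs.length).flatMap (startItem cs) ++ o) := fun o => by
    refine eval_loop_emit fun p hp o => ?_
    rw [eval_read (c := cs[p]) (by simp [hp]), startItem, List.getElem?_eq_getElem hp]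
    rcases cs[p] with ⟨s, _ | _⟩
    case sep => simp [startRule, eval, encodeUnary]
    all_goals rfl
  have h4 : ∀ o : List (OutSymbol A), (loop 0 (emit .tick)).eval cs (fun _ => 0) (t, o) =
      (t, encodeUnary A cs.length ++ o) := fun o => by
    refine (eval_loop_emit (g := fun _ => [.tick]) fun p hp o => rfl).trans ?_
    congr 2
    rw [encodeUnary]
    induction cs.length with
    | zero => rfl
    | succ n ih => rw [List.range_succ, List.flatMap_append, ih]; simp [List.replicate_succ']
  rw [encode_automaton]
  simp only [emitAutomaton]
  simp only [eval.eq_2, h1, h2, h3, h4, eval.eq_7]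
  simp

theorem main_spec (hcs : Padded cs) : ∃ t : List Bool, t.length = cs.length * cs.length ∧
    (seq saturate emitAutomaton).eval cs (fun _ => 0) ([], []) = (t, (automaton cs).encode) := by
  obtain ⟨h1, h2, h3⟩ := saturate_spec (O := OutSymbol A) hcs
  refine ⟨_, h1.1, ?_⟩
  rw [eval]
  rw [← emitAutomaton_spec fun i hi j hj => ⟨h1.2 i hi j hj, h2 i hi j hj⟩]
  exact congrArg _ (Prod.ext rfl h3)

end Cmd

/-! ### The machine -/

open Prog

instance [Finite A] : Finite (Op A) := by
  refine Finite.of_injective (β := A ⊕ Fin 3) (fun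
    | .letter a => .inl a
    | .backspace => .inr 0
    | .leftArrow => .inr 1
    | .rightArrow => .inr 2) ?_
  intro x y h
  cases x <;> cases y <;> simp_all

instance [Finite A] : Finite (Act A) := by
  refine Finite.of_injective (β := A ⊕ Fin 4) (fun
    | .letter a => .inl a
    | .back => .inr 0
    | .endTransient => .inr 1
    | .endFinal => .inr 2
    | .sep => .inr 3) ?_
  intro x y h
  cases x <;> cases y <;> simp_all

instance [Finite A] : Finite (InSymbol A) := by
  refine Finite.of_injective (β := Op A ⊕ Fin 2) (fun
    | .op σ => .inl σ
    | .endKey => .inr 0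
    | .endTransient => .inr 1) ?_
  intro x y h
  cases x <;> cases y <;> simp_all

instance [Finite A] : Finite (OutSymbol A) := by
  refine Finite.of_injective (β := A ⊕ Fin 3) (fun
    | .letter a => .inl a
    | .tick => .inr 0
    | .endItem => .inr 1
    | .endBlock => .inr 2) ?_
  intro x y h
  cases x <;> cases y <;> simp_all

/-- The symbols on the stacks of the machine. -/
abbrev MachineSym (A : Type) : Reg → Type :=
  Reg.Sym (InSymbol A) (Bool × Bool) (Cell A) (OutSymbol A)

instance [Finite A] (p : Reg × Bool) : Finite (MachineSym A p.1) := by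
  obtain ⟨k, b⟩ := p
  cases k <;> dsimp only [MachineSym, Reg.Sym] <;> infer_instance

/-- Run the transducer on the input; the cells are produced in reverse order. -/
def transduce (A : Type) : Prog fun p : Reg × Bool => MachineSym A p.1 :=
  .drain (.inp, false) fun x => .pop (.mealy, false) fun o => o.elim .skip fun q =>
    .seq (.push (.mealy, false) (nextState q x)) (.push (.cells, true) (cellOf q x))

/-- Put the cells in order, and count them. -/
def countCells (A : Type) : Prog fun p : Reg × Bool => MachineSym A p.1 :=
  .drain (.cells, true) fun c => .seq (.push (.cells, false) c) (.push (.size, false) ())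

/-- Replace the input by the array of its cells. -/
def readInput (A : Type) : Prog fun p : Reg × Bool => MachineSym A p.1 :=
  .seq (.push (.mealy, false) (false, true)) (.seq (transduce A) (.seq (countCells A)
    (.drain (.mealy, false) fun _ => .skip)))

/-- Erase everything except the output. -/
def cleanUp (A : Type) : Prog fun p : Reg × Bool => MachineSym A p.1 :=
  .seq (.drain (.cells, false) fun _ => .skip) (.seq (.drain (.table, false) fun _ => .skip)
    (.drain (.size, false) fun _ => .skip))

/-- The program that computes an automaton from a keyboard. -/
def keyboardProg (A : Type) : Prog fun p : Reg × Bool => MachineSym A p.1 :=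
  .seq (readInput A) (.seq (Cmd.seq Cmd.saturate Cmd.emitAutomaton).compile (cleanUp A))

theorem transduce_runs (x : List (InSymbol A)) (q : Bool × Bool)
    (s : ∀ p : Reg × Bool, List (MachineSym A p.1)) (hi : s (.inp, false) = x)
    (hq : s (.mealy, false) = [q]) :
    Runs (transduce A) s (5 * x.length + 1)
      (update (update (update s (.inp, false) []) (.mealy, false) [x.foldl nextState q])
        (.cells, true) ((annotate q x).reverse ++ s (.cells, true))) := by
  induction x generalizing q s with
  | nil =>
    have : update (update (update s (.inp, false) []) (.mealy, false)
        [([] : List (InSymbol A)).foldl nextState q])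
        (.cells, true) ((annotate q []).reverse ++ s (.cells, true)) = s := by
      funext p
      by_cases h1 : p = (.cells, true)
      · subst h1; simp [annotate]
      · by_cases h2 : p = (.mealy, false)
        · subst h2; simp [hq]
        · by_cases h3 : p = (.inp, false)
          · subst h3; simp [hi]
          · simp [h1, h2, h3]
    rw [this]
    exact .drainNil hi (by simp)
  | cons a x ih =>
    set s1 := update s (.inp, false) x with hs1
    set s2 := update s1 (.mealy, false) [] with hs2
    set s3 := update s2 (.mealy, false) (nextState q a :: s2 (.mealy, false)) with hs3
    set s4 := update s3 (.cells, true) (cellOf q a :: s3 (.cells, true)) with hs4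
    have h := ih (nextState q a) s4 rfl rfl
    refine .drainCons (n := 4) hi (.popCons (n := 3) (s' := s4) (a := q) (l := []) (hs1 ▸ hq)
      (.seq (.push le_rfl) (.push le_rfl) le_rfl) le_rfl) (cast ?_ h) (t := _)
      (m := 5 * x.length + 1) (by simp; omega)
    congr 1
    funext p
    by_cases h1 : p = (.cells, true)
    · subst h1
      simp [annotate, hs4, hs3, hs2, hs1]
    · by_cases h2 : p = (.mealy, false)
      · subst h2; simp
      · by_cases h3 : p = (.inp, false)
        · subst h3; simp
        · simp [h1, h2, h3, hs4, hs3, hs2, hs1]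

theorem countCells_runs (l : List (Cell A)) (s : ∀ p : Reg × Bool, List (MachineSym A p.1))
    (hl : s (.cells, true) = l) :
    Runs (countCells A) s (4 * l.length + 1)
      (update (update (update s (.cells, true) []) (.cells, false)
        (l.reverse ++ s (.cells, false)))
        (.size, false) (List.replicate l.length () ++ s (.size, false))) := by
  induction l generalizing s with
  | nil =>
    have : update (update (update s (.cells, true) []) (.cells, false)
        (([] : List (Cell A)).reverse ++ s (.cells, false)))
        (.size, false) (List.replicate ([] : List (Cell A)).length () ++ s (.size, false)) = s := by
      funext p
      by_cases h1 : p = (.cells, true)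
      · subst h1; simp [hl]
      · by_cases h2 : p = (.cells, false)
        · subst h2; simp
        · by_cases h3 : p = (.size, false)
          · subst h3; simp
          · simp [h1, h2, h3]
    rw [this]
    exact .drainNil hl (by simp)
  | cons c l ih =>
    set s1 := update s (.cells, true) l with hs1
    set s2 := update s1 (.cells, false) (c :: s1 (.cells, false)) with hs2
    set s3 := update s2 (.size, false) (() :: s2 (.size, false)) with hs3
    have h := ih s3 rfl
    refine .drainCons (n := 3) (s' := s3) hl (.seq (.push le_rfl) (.push le_rfl) le_rfl)
      (cast ?_ h) (t := _) (m := 4 * l.length + 1) (by simp; omega)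
    congr 1
    funext p
    by_cases h1 : p = (.cells, true)
    · subst h1; simp
    · by_cases h2 : p = (.cells, false)
      · subst h2; simp [hs3, hs2, hs1]
      · by_cases h3 : p = (.size, false)
        · subst h3; simp [hs3, hs2, hs1, List.replicate_succ']
        · simp [h1, h2, h3, hs3, hs2, hs1]

theorem length_annotate (q : Bool × Bool) (x : List (InSymbol A)) :
    (annotate q x).length = x.length := by
  induction x generalizing q with
  | nil => rfl
  | cons a x ih => simp [annotate, ih]

theorem readInput_runs (x : List (InSymbol A)) :
    Runs (readInput A) (update (fun _ => []) (.inp, false) x) (9 * x.length + 9)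
      (Cmd.mem _ _ (annotate (false, true) x) (fun _ => 0) ([], [])) := by
  set s0 : ∀ p : Reg × Bool, List (MachineSym A p.1) := update (fun _ => []) (.inp, false) x
    with hs0
  set s1 := update s0 (.mealy, false) ((false, true) :: s0 (.mealy, false)) with hs1
  have h1 := transduce_runs x (false, true) s1 (by simp [hs1, hs0]) (by simp [hs1, hs0])
  set s2 := update (update (update s1 (.inp, false) []) (.mealy, false)
    [x.foldl nextState (false, true)])
    (.cells, true) ((annotate (false, true) x).reverse ++ s1 (.cells, true)) with hs2
  have h2 := countCells_runs ((annotate (false, true) x).reverse) s2 (by simp [hs2, hs1, hs0])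
  set s3 := update (update (update s2 (.cells, true) []) (.cells, false)
    ((annotate (false, true) x).reverse.reverse ++ s2 (.cells, false)))
    (.size, false) (List.replicate (annotate (false, true) x).reverse.length () ++
      s2 (.size, false)) with hs3
  have h3 := Cmd.clear_runs (Γ := fun p : Reg × Bool => MachineSym A p.1) (.mealy, false) s3
  have e : (s3 (.mealy, false)).length = 1 := by simp [hs3, hs2]
  rw [e] at h3
  rw [List.length_reverse, length_annotate] at h2
  refine .seq (.push le_rfl) (.seq h1 (.seq h2 (m := 3) (cast ?_ h3) le_rfl) le_rfl) (by omega)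
  congr 1
  funext ⟨k, b⟩
  cases b <;> cases k <;> simp [Cmd.mem, hs3, hs2, hs1, hs0]

theorem cleanUp_runs (cs : List (Cell A)) (t : List Bool) (o : List (OutSymbol A)) :
    Runs (cleanUp A) (Cmd.mem _ _ cs (fun _ => 0) (t, o)) (4 * cs.length + 2 * t.length + 5)
      (update (fun _ => []) (.out, false) o) := by
  set s0 : ∀ p : Reg × Bool, List (MachineSym A p.1) := Cmd.mem _ _ cs (fun _ => 0) (t, o) with hs0
  have h1 := Cmd.clear_runs (.cells, false) s0
  set s1 := update s0 (.cells, false) [] with hs1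
  have h2 := Cmd.clear_runs (.table, false) s1
  set s2 := update s1 (.table, false) [] with hs2
  have h3 := Cmd.clear_runs (.size, false) s2
  have e1 : (s0 (.cells, false)).length = cs.length := rfl
  have e2 : (s1 (.table, false)).length = t.length := rfl
  have e3 : (s2 (.size, false)).length = cs.length := List.length_replicate
  rw [e1] at h1
  rw [e2] at h2
  rw [e3] at h3
  refine .seq h1 (.seq h2 (m := 2 * cs.length + 1) (cast ?_ h3) le_rfl) (by omega)
  congr 1
  funext ⟨k, b⟩
  cases b <;> cases k <;> simp [Cmd.mem, hs2, hs1, hs0]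

/-- The Turing machine that computes an automaton from a keyboard. -/
noncomputable def keyboardMachine (A : Type) [Finite A] :
    TM2ComputableAux (InSymbol A) (OutSymbol A) where
  tm := machine (keyboardProg A) (.inp, false) (.out, false)
  inputAlphabet := Equiv.refl (InSymbol A)
  outputAlphabet := Equiv.refl (OutSymbol A)

theorem keyboardMachine_outputs (A : Type) [Finite A] : ∃ p : Polynomial ℕ,
    ∀ x : List (InSymbol A), Cmd.Padded (annotate (false, true) x) →
      OutputsWithin (keyboardMachine A) x (automaton (annotate (false, true) x)).encode
        (p.eval x.length) := by
  obtain ⟨p, hp⟩ := Cmd.compile_runs (I := InSymbol A) (Q := Bool × Bool)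
    (Cmd.seq Cmd.saturate Cmd.emitAutomaton : Cmd (Cell A) (OutSymbol A)) 0 Cmd.scoped_main
  refine ⟨9 * .X + 9 + (p + (4 * .X + 2 * (.X * .X) + 5) + 1) + 1 + 1, fun x hx => ?_⟩
  obtain ⟨t, ht, he⟩ := Cmd.main_spec hx
  have h1 := readInput_runs x
  have h2 := hp (annotate (false, true) x) (fun _ => 0) ([], []) (fun _ => Nat.zero_le _)
    (fun _ _ => rfl)
  rw [he, length_annotate] at h2
  have h3 := cleanUp_runs (annotate (false, true) x) t (automaton (annotate (false, true) x)).encode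
  rw [ht, length_annotate] at h3
  have h := (Runs.seq h1 (.seq h2 h3 le_rfl) le_rfl).outputs
  have e : Polynomial.eval x.length
      (9 * .X + 9 + (p + (4 * .X + 2 * (.X * .X) + 5) + 1) + 1 + 1 : Polynomial ℕ) =
      9 * x.length + 9 + (p.eval x.length + (4 * x.length + 2 * (x.length * x.length) + 5) + 1)
        + 1 + 1 := by
    simp
  rw [e, OutputsWithin]
  have e1 : x.map (keyboardMachine A).inputAlphabet.symm = x := List.map_id x
  have e2 : (automaton (annotate (false, true) x)).encode.map
      (keyboardMachine A).outputAlphabet.symm = (automaton (annotate (false, true) x)).encode :=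
    List.map_id _
  rw [e1, e2]
  exact h

/-! ### The size of a keyboard -/

theorem eval_mono (p : Polynomial ℕ) {m n : ℕ} (h : m ≤ n) : p.eval m ≤ p.eval n := by
  rw [Polynomial.eval_eq_sum_range, Polynomial.eval_eq_sum_range]
  gcongr

theorem length_encodeKeys (l : List (Key A)) :
    (encodeKeys l).length = (l.map fun t => t.length + 1).sum := by
  simp [encodeKeys, List.length_flatMap]

theorem length_encodeKeyboard_le {K : Keyboard A} {T F : List (Key A)} (h : K.IsListing T F) :
    (encodeKeyboard T F).length ≤ 2 * K.size + 1 := by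
  classical
  have key : ∀ (l : List (Key A)) (S : Finset (Key A)), (l : Multiset (Key A)) = S.val →
      S ⊆ K.transientKeys ∪ K.finalKeys → (encodeKeys l).length ≤ K.size := by
    intro l S hl hS
    have : (encodeKeys l).length = ∑ t ∈ S, (t.length + 1) := by
      rw [length_encodeKeys, Finset.sum, ← hl, Multiset.map_coe, Multiset.sum_coe]
    rw [this, Keyboard.size]
    refine Finset.sum_le_sum_of_subset ?_
    convert hS
  have h1 := key T _ h.1 Finset.subset_union_left
  have h2 := key F _ h.2 Finset.subset_union_right
  simp only [encodeKeyboard, List.length_append, List.length_cons]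
  omega

theorem padded_cellsOf (T F : List (Key A)) : Cmd.Padded (cellsOf T F) :=
  fun _ _ h hc => succ_lt_length_cellsOf h hc

end KeyboardLang

theorem mainTheorem1 (A : Type) [Fintype A] :
    (∀ K : KeyboardLang.Keyboard A, K.IsBEK → K.language.IsRegular) ∧
    ∃ (M : Turing.TM2ComputableAux (KeyboardLang.InSymbol A) (KeyboardLang.OutSymbol A))
      (p : Polynomial ℕ),
      ∀ K : KeyboardLang.Keyboard A, K.IsBEK →
        ∀ T F : List (KeyboardLang.Key A), K.IsListing T F →
          ∃ N : KeyboardLang.ListedNFA A,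
            N.toNFA.accepts = K.language ∧
            KeyboardLang.OutputsWithin M (KeyboardLang.encodeKeyboard T F) N.encode
              (p.eval K.size) := by
  constructor
  · intro K hK
    have hL : K.IsListing K.transientKeys.toList K.finalKeys.toList :=
      ⟨Finset.coe_toList _, Finset.coe_toList _⟩
    rw [← KeyboardLang.automaton_accepts_eq_language hK hL, ← NFA.toDFA_correct]
    exact ⟨_, inferInstance, _, rfl⟩
  · obtain ⟨p, hp⟩ := KeyboardLang.keyboardMachine_outputs A
    refine ⟨KeyboardLang.keyboardMachine A, p.comp (2 * .X + 1), fun K hK T F h =>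
      ⟨KeyboardLang.automaton (KeyboardLang.cellsOf T F),
        KeyboardLang.automaton_accepts_eq_language hK h, ?_⟩⟩
    obtain ⟨r⟩ := hp _ (KeyboardLang.padded_cellsOf T F)
    refine ⟨⟨r.toEvalsTo, r.steps_le_m.trans ?_⟩⟩
    rw [Polynomial.eval_comp]
    exact KeyboardLang.eval_mono p
      ((KeyboardLang.length_encodeKeyboard_le h).trans (by simp))
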